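/- Let $p\ge 0$, let $0=t_0<t_1<\dots<t_p<t_{p+1}=b$, and let $h\in L^2(0,\pi)$ have the sine Fourier coefficients $\gamma_m=\frac{2}{\pi}\int_0^\pi h(\theta)\sin(m\theta)\,d\theta$, $m\ge 1$. Let $H$ be the Hilbert space of pairs $(a,b)$ of functions $a=\sum_{m\ge1}\alpha_m\sin m\theta$, $b=\sum_{m\ge1}\beta_m\sin m\theta$ on $(0,\pi)$ with $\|(a,b)\|_H^2=\sum_{m\ge1}(m^2\alpha_m^2+\beta_m^2)<\infty$ (that is, $H=H^1_0(0,\pi)\times L^2(0,\pi)$), and let $(a_i,b_i)\in H$, $i=1,\dots,p$, be given. Consider the controlled wave equation on $(0,\pi)$ with impulses $$\frac{\partial^2x}{\partial t^2}(t,\theta)=\frac{\partial^2x}{\partial\theta^2}(t,\theta)+h(\theta)u(t),\quad t\in[0,b]\setminus\{t_1,\dots,t_p\},\qquad x(t,0)=x(t,\pi)=0,$$ $$\Delta x(t_i,\theta)=a_i(\theta),\qquad \Delta\frac{\partial x}{\partial t}(t_i,\theta)=b_i(\theta),\qquad i=1,\dots,p,$$ with scalar control $u\in L^2([0,b],\mathbb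 R)$ and initial state $\left(x,\frac{\partial x}{\partial t}\right)\big|_{t=0}=z_0\in H$. Here $\Delta f(t_i)=f(t_i^+)-f(t_i^-)$, $f(t_i)=f(t_i^-)$, and solutions are weak solutions for which $t\mapsto\left(x,\frac{\partial x}{\partial t}\right)(t)$ is an $H$-valued function, continuous except for the prescribed jumps. If $b-t_p\ge 2\pi$ and $\gamma_m\ne0$ for all $m=1,2,\dots$, then the system is approximately controllable on $[0,b]$: for all $z_0,z_1\in H$ and every $\varepsilon>0$ there is a control $u\in L^2([0,b],\mathbb R)$ for which the system has a solution with initial state $z_0$, and every such solution satisfies $\left\|\left(x,\frac{\partial x}{\partial t}\right)(b)-z_1\right\|_H<\varepsilon$. -/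

import Mathlib

open MeasureTheory Set Filter Topology

noncomputable section

namespace ImpulsiveWave

/-- The real Hilbert space `L²(0, π)`. -/
abbrev L2 : Type := Lp ℝ 2 (volume.restrict (Ioo (0 : ℝ) Real.pi))

/-- A state of the string: the pair (position, velocity). -/
abbrev State : Type := L2 × L2

/-- The pairing `∫₀^π f(θ) φ(θ) dθ` of an `L²(0, π)` function with a function `φ`. -/
def pairing (f : L2) (φ : ℝ → ℝ) : ℝ :=
  ∫ θ in Ioo (0 : ℝ) Real.pi, f θ * φ θ

/-- The `m`-th sine Fourier coefficient `(2/π) ∫₀^π f(θ) sin(mθ) dθ`, so that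
`f(θ) = ∑_{m ≥ 1} (sineCoeff f m) sin(mθ)` in `L²(0, π)`. For `m = 0` it is zero. -/
def sineCoeff (f : L2) (m : ℕ) : ℝ :=
  2 / Real.pi * pairing f (fun θ => Real.sin (m * θ))

/-- The `m`-th term `m² α_m² + β_m²` of the energy of a state
(it vanishes for `m = 0`). -/
def energyTerm (z : State) (m : ℕ) : ℝ :=
  (m : ℝ) ^ 2 * sineCoeff z.1 m ^ 2 + sineCoeff z.2 m ^ 2

/-- The state space `H`: the pairs `(a, b)` whose sine coefficients satisfy
`∑ (m² α_m² + β_m²) < ∞`. This is `H₀¹(0, π) × L²(0, π)`: the position component vanishes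
at `0` and at `π`. -/
def stateSpace : Set State :=
  {z | Summable (energyTerm z)}

/-- The norm `(∑ (m² α_m² + β_m²))^{1/2}` of `H`. -/
def energyNorm (z : State) : ℝ :=
  √(∑' m : ℕ, energyTerm z m)

/-- `x = (y, ∂y/∂t)` is the (weak, finite energy) solution on `[0, b]` of the impulsive
controlled wave equation `∂²y/∂t² = ∂²y/∂θ² + h u(t)`, `y(t,0) = y(t,π) = 0`, with initial
state `z₀`, and with jumps `J i = (aᵢ, bᵢ)` of `(y, ∂y/∂t)` at the impulse times.
The times `t 0 < t 1 < … < t p < t (p+1)` are `0 = t₀ < t₁ < … < t_p < t_{p+1} = b`. -/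
structure IsSolution {p : ℕ} (t : Fin (p + 2) → ℝ) (h : L2) (J : Fin p → State)
    (z₀ : State) (u : ℝ → ℝ) (x : ℝ → State) : Prop where
  /-- At each time the state belongs to `H` (in particular `y(s, ·) ∈ H₀¹(0, π)`). -/
  mem : ∀ s ∈ Icc (t 0) (t (Fin.last (p + 1))), x s ∈ stateSpace
  /-- The initial condition. -/
  init : x (t 0) = z₀
  /-- The trajectory is left-continuous in `H`, so that `x(tᵢ⁻) = x(tᵢ)`. -/
  left_cont : ∀ s ∈ Ioc (t 0) (t (Fin.last (p + 1))),
    Tendsto (fun r => energyNorm (x r - x s)) (𝓝[<] s) (𝓝 0)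
  /-- The trajectory is right-continuous in `H` at the times that are not impulse times. -/
  right_cont : ∀ s ∈ Ico (t 0) (t (Fin.last (p + 1))), (∀ i : Fin p, s ≠ t i.castSucc.succ) →
    Tendsto (fun r => energyNorm (x r - x s)) (𝓝[>] s) (𝓝 0)
  /-- The impulses: `x(tᵢ⁺) - x(tᵢ) = (aᵢ, bᵢ)`. -/
  jump : ∀ i : Fin p,
    Tendsto (fun r => energyNorm (x r - (x (t i.castSucc.succ) + J i)))
      (𝓝[>] (t i.castSucc.succ)) (𝓝 0)
  /-- Between impulses the second component is the time derivative of the first, in `L²`. -/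
  velocity : ∀ k : Fin (p + 1), ∀ s ∈ Ioo (t k.castSucc) (t k.succ),
    HasDerivAt (fun r => (x r).1) (x s).2 s
  /-- Between impulses `∂²y/∂t² = ∂²y/∂θ² + h u` in the weak sense with Dirichlet boundary
  conditions: for every `C²` function `φ` with `φ(0) = φ(π) = 0`, the function
  `s ↦ ⟨∂y/∂t(s), φ⟩` is absolutely continuous, with derivative `⟨y(s), φ''⟩ + ⟨h, φ⟩ u(s)`. -/
  wave : ∀ k : Fin (p + 1), ∀ r ∈ Ioo (t k.castSucc) (t k.succ),
    ∀ s ∈ Ioo (t k.castSucc) (t k.succ), ∀ φ : ℝ → ℝ, ContDiff ℝ 2 φ → φ 0 = 0 →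
    φ Real.pi = 0 →
      pairing (x s).2 φ - pairing (x r).2 φ =
        ∫ τ in r..s, (pairing (x τ).1 (deriv (deriv φ)) + pairing h φ * u τ)

/-- Approximate controllability on `[0, b]`: from every initial state in `H`, every
neighbourhood of every state in `H` is reached at time `b` with a suitable control
`u ∈ L²(0, b)`. The trajectory for this control exists, and every trajectory
for this control ends in the neighbourhood. -/
def ApproximatelyControllable {p : ℕ} (t : Fin (p + 2) → ℝ) (h : L2) (J : Fin p → State) :
    Prop :=
  ∀ z₀ ∈ stateSpace, ∀ z₁ ∈ stateSpace, ∀ ε > (0 : ℝ),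
    ∃ u : ℝ → ℝ, MemLp u 2 (volume.restrict (Icc (t 0) (t (Fin.last (p + 1))))) ∧
      (∃ x : ℝ → State, IsSolution t h J z₀ u x) ∧
      ∀ x : ℝ → State, IsSolution t h J z₀ u x →
        energyNorm (x (t (Fin.last (p + 1))) - z₁) < ε

end ImpulsiveWave

end

/-! The equation is linear, so an impulse at `t_i` only superposes, after `t_i`, the free trajectory
that equals `J i` at `t_i`. At time `b` the impulses contribute a state that does not depend on the
control, and the control only has to correct the error `y` between the uncontrolled final state and
the target.

In sine modes the equation decouples into oscillators. By Duhamel's formula a control adds `γ_m ∫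
sin(m(b-τ)) u(τ) dτ` to `m α_m(b)` and `γ_m ∫ cos(m(b-τ)) u(τ) dτ` to `β_m(b)`. Take `u` to be a
trigonometric polynomial of degree `N` in `b - τ` on the last `2π` units of time and zero before.
Orthogonality on `[0, 2π]` and `γ_m ≠ 0` let it cancel modes `1, …, N` of `y` exactly and leave all
higher modes untouched (`exists_control_cancelling_modes`). The remaining error is a tail of the
convergent energy series of `y` (`exists_energyNorm_lt`).

Existence of solutions comes from `exists_trajectory` and `isSolution_superpose`. Every other
solution ends in the same state, because the difference of two solutions has no jumps and conserves
each modal energy (`IsSolution.last_unique`). -/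

noncomputable section

namespace ImpulsiveWave

/-! ### Sine coefficients and orthonormality on `(0, π)` -/

/-- Lebesgue measure on `(0, π)`. -/
abbrev stringMeasure : Measure ℝ := volume.restrict (Ioo (0 : ℝ) Real.pi)

theorem memLp_of_continuous {φ : ℝ → ℝ} (hφ : Continuous φ) : MemLp φ 2 stringMeasure := by
  obtain ⟨C, hC⟩ := (isCompact_Icc (a := (0 : ℝ)) (b := Real.pi)).exists_bound_of_continuousOn
    hφ.continuousOn
  refine MemLp.of_bound hφ.aestronglyMeasurable C ?_
  exact (ae_restrict_iff' measurableSet_Ioo).2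
    (Eventually.of_forall fun x hx => hC x (Ioo_subset_Icc_self hx))

/-- A continuous function as an element of `L²(0, π)`. -/
def contLp (φ : ℝ → ℝ) (hφ : Continuous φ) : L2 := (memLp_of_continuous hφ).toLp φ

theorem coeFn_contLp (φ : ℝ → ℝ) (hφ : Continuous φ) :
    contLp φ hφ =ᵐ[stringMeasure] φ := MemLp.coeFn_toLp _

theorem pairing_eq_inner (f : L2) {φ : ℝ → ℝ} (hφ : Continuous φ) :
    pairing f φ = inner ℝ (contLp φ hφ) f := by
  rw [MeasureTheory.L2.inner_def, pairing]
  refine integral_congr_ae ?_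
  filter_upwards [coeFn_contLp φ hφ] with x hx
  simp [hx]

theorem pairing_contLp {φ : ℝ → ℝ} (hφ : Continuous φ) (ψ : ℝ → ℝ) :
    pairing (contLp φ hφ) ψ = ∫ θ in (0 : ℝ)..Real.pi, φ θ * ψ θ := by
  rw [intervalIntegral.integral_of_le Real.pi_pos.le, integral_Ioc_eq_integral_Ioo, pairing]
  refine integral_congr_ae ?_
  filter_upwards [coeFn_contLp φ hφ] with x hx
  simp [hx]

theorem continuous_sin_mul (m : ℝ) : Continuous fun θ : ℝ => Real.sin (m * θ) := by fun_prop

/-- The function `θ ↦ sin (m θ)` in `L²(0, π)`. -/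
def sineLp (m : ℕ) : L2 := contLp (fun θ => Real.sin (m * θ)) (continuous_sin_mul m)

/-- The sine coefficient as a continuous linear functional. -/
def sineCoeffL (m : ℕ) : L2 →L[ℝ] ℝ := (2 / Real.pi) • innerSL ℝ (sineLp m)

theorem sineCoeff_eq (f : L2) (m : ℕ) : sineCoeff f m = sineCoeffL m f := by
  simp [sineCoeff, sineCoeffL, pairing_eq_inner f (continuous_sin_mul m), sineLp]

theorem sineCoeff_add (f g : L2) (m : ℕ) :
    sineCoeff (f + g) m = sineCoeff f m + sineCoeff g m := by simp [sineCoeff_eq]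

theorem sineCoeff_sub (f g : L2) (m : ℕ) :
    sineCoeff (f - g) m = sineCoeff f m - sineCoeff g m := by simp [sineCoeff_eq]

theorem sineCoeff_smul (c : ℝ) (f : L2) (m : ℕ) :
    sineCoeff (c • f) m = c * sineCoeff f m := by simp [sineCoeff_eq]

@[simp] theorem sineCoeff_zero_left (m : ℕ) : sineCoeff 0 m = 0 := by simp [sineCoeff_eq]

@[simp] theorem sineCoeff_zero_right (f : L2) : sineCoeff f 0 = 0 := by
  simp [sineCoeff, pairing]

theorem integral_cos_int_mul_pi (k : ℤ) :
    ∫ θ in (0 : ℝ)..Real.pi, Real.cos (k * θ) = if k = 0 then Real.pi else 0 := by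
  split_ifs with hk
  · simp [hk]
  · have : (k : ℝ) ≠ 0 := by exact_mod_cast hk
    rw [intervalIntegral.integral_comp_mul_left (fun x => Real.cos x) this]
    simp [Real.sin_int_mul_pi]

theorem integral_sin_mul_sin_pi (m n : ℕ) (hm : 1 ≤ m) :
    ∫ θ in (0 : ℝ)..Real.pi, Real.sin (m * θ) * Real.sin (n * θ) =
      if m = n then Real.pi / 2 else 0 := by
  have h1 : ∀ θ : ℝ, Real.sin (m * θ) * Real.sin (n * θ) =
      (1 / 2) * (Real.cos (((m - n : ℤ) : ℝ) * θ) - Real.cos (((m + n : ℤ) : ℝ) * θ)) := by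
    intro θ
    push_cast
    rw [sub_mul, add_mul, Real.cos_sub, Real.cos_add]
    ring
  simp only [h1]
  rw [intervalIntegral.integral_const_mul, intervalIntegral.integral_sub
    (Continuous.intervalIntegrable (by fun_prop) _ _)
    (Continuous.intervalIntegrable (by fun_prop) _ _), integral_cos_int_mul_pi,
    integral_cos_int_mul_pi]
  have h2 : (m + n : ℤ) ≠ 0 := by omega
  have h3 : (m - n : ℤ) = 0 ↔ m = n := by omega
  simp only [h2, h3, if_false]
  split_ifs <;> ring

theorem inner_sineLp (m n : ℕ) (hn : 1 ≤ n) :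
    inner ℝ (sineLp m) (sineLp n) = if m = n then Real.pi / 2 else 0 := by
  rw [sineLp, ← pairing_eq_inner _ (continuous_sin_mul m), sineLp, pairing_contLp, integral_sin_mul_sin_pi n m hn]
  simp [eq_comm]

/-- The normalized sine functions `√(2/π) sin ((n + 1) θ)`. -/
def sineVec (n : ℕ) : L2 := √(2 / Real.pi) • sineLp (n + 1)

theorem orthonormal_sineVec : Orthonormal ℝ sineVec := by
  rw [orthonormal_iff_ite]
  intro i j
  rw [sineVec, sineVec, real_inner_smul_left, real_inner_smul_right, inner_sineLp _ _ (by omega),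
    ← mul_assoc, Real.mul_self_sqrt (by positivity)]
  have := Real.pi_ne_zero
  split_ifs with h1 h2 h2 <;> first | omega | simp

theorem integrable_mul_continuous (f : L2) {φ : ℝ → ℝ} (hφ : Continuous φ) :
    Integrable (fun θ => f θ * φ θ) stringMeasure :=
  (Lp.memLp f).integrable_mul (memLp_of_continuous hφ)

theorem pairing_add_right (f : L2) {φ ψ : ℝ → ℝ} (hφ : Continuous φ) (hψ : Continuous ψ) :
    pairing f (fun θ => φ θ + ψ θ) = pairing f φ + pairing f ψ := by
  simp only [pairing, mul_add]
  exact integral_add (integrable_mul_continuous f hφ) (integrable_mul_continuous f hψ)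

theorem pairing_const_mul_right (f : L2) (c : ℝ) (φ : ℝ → ℝ) :
    pairing f (fun θ => c * φ θ) = c * pairing f φ := by
  simp only [pairing, mul_left_comm _ c]
  exact integral_const_mul _ _

/-! ### Completeness of the sine system and Parseval's identity -/

section Completeness

variable {f : L2}

/-- Each factor `cos θ` is absorbed by `2 cos θ sin(nθ) = sin((n+1)θ) + sin((n-1)θ)`. Only the case
`m = 1` is used afterwards, but the induction needs all `m`. -/
theorem pairing_cos_pow_mul_sin (hf : ∀ m : ℕ, pairing f (fun θ => Real.sin (m * θ)) = 0)
    (k : ℕ) : ∀ m : ℕ, pairing f (fun θ => Real.cos θ ^ k * Real.sin (m * θ)) = 0 := by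
  induction k with
  | zero => simpa using hf
  | succ k ih =>
    rintro (_ | m)
    · simp [pairing]
    · have h1 : (fun θ : ℝ => Real.cos θ ^ (k + 1) * Real.sin ((m + 1 : ℕ) * θ)) =
          fun θ => (1 / 2) * (Real.cos θ ^ k * Real.sin ((m + 2 : ℕ) * θ)) +
            (1 / 2) * (Real.cos θ ^ k * Real.sin (m * θ)) := by
        funext θ
        have h2 : ((m + 2 : ℕ) : ℝ) * θ = (m + 1 : ℕ) * θ + θ := by push_cast; ring
        have h3 : (m : ℝ) * θ = (m + 1 : ℕ) * θ - θ := by push_cast; ring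
        rw [h2, h3, Real.sin_add, Real.sin_sub]
        ring
      rw [h1, pairing_add_right f (by fun_prop) (by fun_prop), pairing_const_mul_right,
        pairing_const_mul_right, ih, ih]
      simp

theorem pairing_polynomial_cos_mul_sin
    (hf : ∀ m : ℕ, pairing f (fun θ => Real.sin (m * θ)) = 0) (p : Polynomial ℝ) :
    pairing f (fun θ => p.eval (Real.cos θ) * Real.sin θ) = 0 := by
  induction p using Polynomial.induction_on' with
  | add p q hp hq =>
    simp only [Polynomial.eval_add, add_mul]
    have hc (r : Polynomial ℝ) : Continuous fun θ => r.eval (Real.cos θ) * Real.sin θ :=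
      (r.continuous.comp Real.continuous_cos).mul Real.continuous_sin
    rw [pairing_add_right f (hc p) (hc q), hp, hq, add_zero]
  | monomial n a =>
    simp only [Polynomial.eval_monomial, mul_assoc]
    rw [pairing_const_mul_right]
    have := pairing_cos_pow_mul_sin hf n 1
    simp only [Nat.cast_one, one_mul] at this
    rw [this, mul_zero]

/-- Weierstrass approximation in the variable `y = cos θ`: on `(0, π)` every continuous `ψ` is a
uniform limit of polynomials in `cos θ`. -/
theorem pairing_mul_sin_eq_zero
    (hf : ∀ m : ℕ, pairing f (fun θ => Real.sin (m * θ)) = 0) {ψ : ℝ → ℝ} (hψ : Continuous ψ) :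
    pairing f (fun θ => ψ θ * Real.sin θ) = 0 := by
  have hfi : Integrable f stringMeasure := (Lp.memLp f).integrable (by norm_num)
  refine abs_eq_zero.1 (le_antisymm (le_of_forall_gt_imp_ge_of_dense ?_) (abs_nonneg _))
  intro ε hε
  set I := ∫ θ, |f θ| ∂stringMeasure with hI
  have hI0 : 0 ≤ I := integral_nonneg fun _ => abs_nonneg _
  -- Dividing by `I + 1` instead of `I` covers the case `I = 0`.
  obtain ⟨p, hp⟩ := exists_polynomial_near_of_continuousOn (-1) 1 (fun y => ψ (Real.arccos y))
    (hψ.comp Real.continuous_arccos).continuousOn (ε / (I + 1)) (by positivity)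
  have hpc : Continuous fun θ => p.eval (Real.cos θ) := p.continuous.comp Real.continuous_cos
  have h1 : pairing f (fun θ => ψ θ * Real.sin θ) =
      pairing f (fun θ => (ψ θ - p.eval (Real.cos θ)) * Real.sin θ) := by
    have h2 : (fun θ => ψ θ * Real.sin θ) =
        fun θ => (ψ θ - p.eval (Real.cos θ)) * Real.sin θ + p.eval (Real.cos θ) * Real.sin θ := by
      funext θ; ring
    rw [h2, pairing_add_right f (by fun_prop) (by fun_prop), pairing_polynomial_cos_mul_sin hf,
      add_zero]
  rw [h1, pairing, ← Real.norm_eq_abs]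
  calc _ ≤ ∫ θ in Ioo (0 : ℝ) Real.pi, ε / (I + 1) * |f θ| := by
        refine norm_integral_le_of_norm_le (hfi.abs.const_mul _) ?_
        refine (ae_restrict_iff' measurableSet_Ioo).2 (Eventually.of_forall fun θ hθ => ?_)
        have h3 := hp (Real.cos θ) ⟨Real.neg_one_le_cos θ, Real.cos_le_one θ⟩
        rw [Real.arccos_cos hθ.1.le hθ.2.le, abs_sub_comm] at h3
        rw [Real.norm_eq_abs, abs_mul, abs_mul, mul_comm]
        have h4 := Real.abs_sin_le_one θ
        have h5 : |ψ θ - p.eval (Real.cos θ)| * |Real.sin θ| ≤ ε / (I + 1) * 1 :=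
          mul_le_mul h3.le h4 (abs_nonneg _) (by positivity)
        have := abs_nonneg (f θ)
        nlinarith
    _ = ε / (I + 1) * I := integral_const_mul _ _
    _ ≤ ε := by
        rw [div_mul_eq_mul_div, div_le_iff₀ (by positivity)]
        nlinarith

theorem eq_zero_of_pairing_sin (hf : ∀ m : ℕ, pairing f (fun θ => Real.sin (m * θ)) = 0) :
    f = 0 := by
  have hfi : Integrable (fun θ => f θ * Real.sin θ) stringMeasure :=
    integrable_mul_continuous f Real.continuous_sin
  -- Test functions supported in `(0, π)` show that `f sin` vanishes almost everywhere; `sin > 0`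
  -- there then gives `f = 0`.
  have h1 : ∀ᵐ x, x ∈ Ioo (0 : ℝ) Real.pi → f x * Real.sin x = 0 := by
    refine isOpen_Ioo.ae_eq_zero_of_integral_contDiff_smul_eq_zero
      (IntegrableOn.locallyIntegrableOn hfi) ?_
    intro g hg _ hgs
    have h2 := pairing_mul_sin_eq_zero hf hg.continuous
    rw [pairing] at h2
    rw [← setIntegral_eq_integral_of_forall_compl_eq_zero (s := Ioo (0 : ℝ) Real.pi)]
    · refine Eq.trans ?_ h2
      refine integral_congr_ae (Eventually.of_forall fun x => ?_)
      simp only [smul_eq_mul]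
      ring
    · intro x hx
      rw [image_eq_zero_of_notMem_tsupport fun h => hx (hgs h), zero_smul]
  rw [Lp.eq_zero_iff_ae_eq_zero]
  filter_upwards [(ae_restrict_iff' measurableSet_Ioo).2 h1,
    ae_restrict_mem measurableSet_Ioo] with x hx hx'
  exact (mul_eq_zero.1 hx).resolve_right (Real.sin_pos_of_mem_Ioo hx').ne'

end Completeness

theorem eq_zero_of_sineCoeff {f : L2} (hf : ∀ m, sineCoeff f m = 0) : f = 0 := by
  refine eq_zero_of_pairing_sin fun m => ?_
  have := hf m
  rw [sineCoeff] at this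
  exact (mul_eq_zero.1 this).resolve_left (by positivity)

theorem ext_sineCoeff {f g : L2} (hfg : ∀ m, sineCoeff f m = sineCoeff g m) : f = g :=
  sub_eq_zero.1 (eq_zero_of_sineCoeff fun m => by rw [sineCoeff_sub, hfg, sub_self])

theorem inner_sineVec (f : L2) (n : ℕ) :
    inner ℝ (sineVec n) f = √(Real.pi / 2) * sineCoeff f (n + 1) := by
  rw [sineVec, real_inner_smul_left, sineCoeff_eq, sineCoeffL]
  simp only [smul_apply, innerSL_apply_apply, smul_eq_mul, ← mul_assoc]
  congr 1
  have h1 : 2 / Real.pi = (Real.pi / 2)⁻¹ := by rw [inv_div]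
  rw [h1, Real.sqrt_inv]
  have h2 : √(Real.pi / 2) ≠ 0 := by positivity
  have h3 := Real.mul_self_sqrt (show 0 ≤ Real.pi / 2 by positivity)
  field_simp
  rw [sq, h3]
  field_simp

/-- The Hilbert basis of normalized sine functions. -/
def sineBasis : HilbertBasis ℕ ℝ L2 :=
  HilbertBasis.mkOfOrthogonalEqBot orthonormal_sineVec <| by
    rw [eq_bot_iff]
    intro f hf
    refine eq_zero_of_sineCoeff fun m => ?_
    rcases m with _ | n
    · simp
    · have h1 : inner ℝ (sineVec n) f = (0 : ℝ) :=
        (Submodule.mem_orthogonal _ _).1 hf _ (Submodule.subset_span (mem_range_self n))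
      rw [inner_sineVec] at h1
      exact (mul_eq_zero.1 h1).resolve_left (by positivity)

theorem sineBasis_apply (n : ℕ) : sineBasis n = sineVec n := by
  simp [sineBasis]

/-- Parseval's identity for the sine coefficients. -/
theorem hasSum_sineCoeff_mul (f g : L2) :
    HasSum (fun m => sineCoeff f m * sineCoeff g m) (2 / Real.pi * inner ℝ f g) := by
  have h1 := (sineBasis.hasSum_inner_mul_inner f g).mul_left (2 / Real.pi)
  -- The basis index `n` is the mode `n + 1`; mode `0` contributes nothing.
  rw [← hasSum_nat_add_iff' 1]
  simp only [Finset.range_one, Finset.sum_singleton, sineCoeff_zero_right, mul_zero, sub_zero]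
  refine h1.congr_fun fun n => ?_
  rw [sineBasis_apply, real_inner_comm, inner_sineVec, inner_sineVec]
  have h3 := Real.mul_self_sqrt (show 0 ≤ Real.pi / 2 by positivity)
  rw [mul_mul_mul_comm, h3, ← mul_assoc]
  have := Real.pi_ne_zero
  field_simp

theorem summable_sineCoeff_sq (f : L2) : Summable fun m => sineCoeff f m ^ 2 := by
  simpa only [sq] using (hasSum_sineCoeff_mul f f).summable

theorem norm_sq_eq_tsum (f : L2) : ‖f‖ ^ 2 = Real.pi / 2 * ∑' m, sineCoeff f m ^ 2 := by
  have := (hasSum_sineCoeff_mul f f).tsum_eq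
  simp only [← sq] at this
  rw [this, real_inner_self_eq_norm_sq]
  have := Real.pi_ne_zero
  field_simp

/-- Riesz–Fischer. The condition `c 0 = 0` is forced because `sin(0 · θ)` vanishes. -/
theorem exists_sineCoeff_eq {c : ℕ → ℝ} (hc : Summable fun m => c m ^ 2) (hc0 : c 0 = 0) :
    ∃ f : L2, ∀ m, sineCoeff f m = c m := by
  have h1 : Memℓp (fun n => √(Real.pi / 2) * c (n + 1)) 2 := by
    rw [memℓp_gen_iff (by norm_num)]
    have := ((summable_nat_add_iff 1).2 hc).mul_left (√(Real.pi / 2) ^ 2)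
    simpa [mul_pow, abs_of_nonneg] using this
  refine ⟨sineBasis.repr.symm ⟨_, h1⟩, ?_⟩
  rintro (_ | n)
  · simp [hc0]
  · have h2 := sineBasis.repr_apply_apply (sineBasis.repr.symm ⟨_, h1⟩) n
    rw [LinearIsometryEquiv.apply_symm_apply, sineBasis_apply, inner_sineVec] at h2
    exact (mul_left_cancel₀ (by positivity) h2).symm

/-! ### The energy norm -/

theorem energyTerm_nonneg (z : State) (m : ℕ) : 0 ≤ energyTerm z m := by
  unfold energyTerm; positivity

theorem energyTerm_add_le (z w : State) (m : ℕ) :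
    energyTerm (z + w) m ≤ 2 * energyTerm z m + 2 * energyTerm w m := by
  simp only [energyTerm, Prod.fst_add, Prod.snd_add, sineCoeff_add]
  nlinarith [sq_nonneg (sineCoeff z.2 m - sineCoeff w.2 m),
    sq_nonneg (m * (sineCoeff z.1 m - sineCoeff w.1 m))]

@[simp] theorem energyTerm_zero (m : ℕ) : energyTerm 0 m = 0 := by simp [energyTerm]

theorem energyTerm_neg (z : State) (m : ℕ) : energyTerm (-z) m = energyTerm z m := by
  simp [energyTerm, sineCoeff_eq]

theorem zero_mem_stateSpace : (0 : State) ∈ stateSpace := by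
  exact summable_zero.congr fun m => (energyTerm_zero m).symm

theorem add_mem_stateSpace {z w : State} (hz : z ∈ stateSpace) (hw : w ∈ stateSpace) :
    z + w ∈ stateSpace :=
  Summable.of_nonneg_of_le (energyTerm_nonneg _) (energyTerm_add_le z w)
    ((hz.mul_left 2).add (hw.mul_left 2))

theorem neg_mem_stateSpace {z : State} (hz : z ∈ stateSpace) : -z ∈ stateSpace :=
  hz.congr fun m => (energyTerm_neg z m).symm

theorem sub_mem_stateSpace {z w : State} (hz : z ∈ stateSpace) (hw : w ∈ stateSpace) :
    z - w ∈ stateSpace := by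
  rw [sub_eq_add_neg]; exact add_mem_stateSpace hz (neg_mem_stateSpace hw)

theorem sum_mem_stateSpace {ι : Type*} (s : Finset ι) {z : ι → State}
    (hz : ∀ i ∈ s, z i ∈ stateSpace) : ∑ i ∈ s, z i ∈ stateSpace :=
  Finset.sum_induction z (· ∈ stateSpace) (fun _ _ => add_mem_stateSpace) zero_mem_stateSpace hz

theorem energyNorm_nonneg (z : State) : 0 ≤ energyNorm z := Real.sqrt_nonneg _

@[simp] theorem energyNorm_zero : energyNorm 0 = 0 := by simp [energyNorm]

theorem energyNorm_neg (z : State) : energyNorm (-z) = energyNorm z := by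
  simp [energyNorm, energyTerm_neg]

theorem energyNorm_sub_comm (z w : State) : energyNorm (z - w) = energyNorm (w - z) := by
  rw [← energyNorm_neg, neg_sub]

theorem energyNorm_sq (z : State) : energyNorm z ^ 2 = ∑' m, energyTerm z m :=
  Real.sq_sqrt (tsum_nonneg (energyTerm_nonneg z))

/-- The crude factor `2` suffices, as the bound only serves to show that sums of null families are
null. -/
theorem energyNorm_add_le {z w : State} (hz : z ∈ stateSpace) (hw : w ∈ stateSpace) :
    energyNorm (z + w) ≤ 2 * (energyNorm z + energyNorm w) := by
  have h1 : ∑' m, energyTerm (z + w) m ≤ ∑' m, (2 * energyTerm z m + 2 * energyTerm w m) :=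
    (add_mem_stateSpace hz hw).tsum_le_tsum (energyTerm_add_le z w)
      ((hz.mul_left 2).add (hw.mul_left 2))
  rw [(hz.mul_left 2).tsum_add (hw.mul_left 2), tsum_mul_left, tsum_mul_left, ← energyNorm_sq,
    ← energyNorm_sq, ← energyNorm_sq] at h1
  have hz0 := energyNorm_nonneg z
  have hw0 := energyNorm_nonneg w
  refine abs_le_of_sq_le_sq' ?_ (by positivity) |>.2
  nlinarith [mul_nonneg hz0 hw0]

theorem tendsto_energyNorm_add {ι : Type*} {l : Filter ι} {z w : ι → State}
    (hz : ∀ᶠ i in l, z i ∈ stateSpace) (hw : ∀ᶠ i in l, w i ∈ stateSpace)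
    (hz0 : Tendsto (fun i => energyNorm (z i)) l (𝓝 0))
    (hw0 : Tendsto (fun i => energyNorm (w i)) l (𝓝 0)) :
    Tendsto (fun i => energyNorm (z i + w i)) l (𝓝 0) := by
  have h1 : Tendsto (fun i => 2 * (energyNorm (z i) + energyNorm (w i))) l (𝓝 0) := by
    simpa using (hz0.add hw0).const_mul 2
  refine tendsto_of_tendsto_of_tendsto_of_le_of_le' tendsto_const_nhds h1
    (Eventually.of_forall fun i => energyNorm_nonneg _) ?_
  filter_upwards [hz, hw] with i hzi hwi using energyNorm_add_le hzi hwi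

theorem energyTerm_le_energyNorm_sq {z : State} (hz : z ∈ stateSpace) (m : ℕ) :
    energyTerm z m ≤ energyNorm z ^ 2 := by
  rw [energyNorm_sq]
  exact hz.le_tsum m fun _ _ => energyTerm_nonneg _ _

theorem abs_sineCoeff_fst_le {z : State} (hz : z ∈ stateSpace) (m : ℕ) :
    |sineCoeff z.1 m| ≤ energyNorm z := by
  refine abs_le_of_sq_le_sq ((?_ : _ ≤ _).trans (energyTerm_le_energyNorm_sq hz m))
    (energyNorm_nonneg z)
  rcases m with _ | m
  · simpa using energyTerm_nonneg z 0
  · have h1 : (1 : ℝ) ≤ ((m + 1 : ℕ) : ℝ) ^ 2 := one_le_pow₀ (by simp)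
    unfold energyTerm
    nlinarith [sq_nonneg (sineCoeff z.1 (m + 1)), sq_nonneg (sineCoeff z.2 (m + 1))]

theorem abs_sineCoeff_snd_le {z : State} (hz : z ∈ stateSpace) (m : ℕ) :
    |sineCoeff z.2 m| ≤ energyNorm z := by
  refine abs_le_of_sq_le_sq ((?_ : _ ≤ _).trans (energyTerm_le_energyNorm_sq hz m))
    (energyNorm_nonneg z)
  unfold energyTerm
  nlinarith [sq_nonneg (m * sineCoeff z.1 m)]

/-- This turns continuity in energy into continuity of the velocity in `L²`, so that velocities can
be integrated in time. -/
theorem norm_snd_le_energyNorm {z : State} (hz : z ∈ stateSpace) :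
    ‖z.2‖ ≤ √(Real.pi / 2) * energyNorm z := by
  refine abs_le_of_sq_le_sq' ?_ (by have := energyNorm_nonneg z; positivity) |>.2
  rw [mul_pow, Real.sq_sqrt (by positivity), norm_sq_eq_tsum, energyNorm_sq]
  refine mul_le_mul_of_nonneg_left ?_ (by positivity)
  refine (summable_sineCoeff_sq z.2).tsum_le_tsum (fun m => ?_) hz
  unfold energyTerm
  nlinarith [sq_nonneg (m * sineCoeff z.1 m)]

/-! ### Trajectories without impulses, assembled from modes -/

/-- A finite energy trajectory, without impulses, of the wave equation with forcing `h u`. -/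
structure IsTrajectory (h : L2) (u : ℝ → ℝ) (w : ℝ → State) : Prop where
  mem : ∀ s, w s ∈ stateSpace
  cont : ∀ s, Tendsto (fun r => energyNorm (w r - w s)) (𝓝 s) (𝓝 0)
  velocity : ∀ s, HasDerivAt (fun r => (w r).1) (w s).2 s
  wave : ∀ r s, ∀ φ : ℝ → ℝ, ContDiff ℝ 2 φ → φ 0 = 0 → φ Real.pi = 0 →
    pairing (w s).2 φ - pairing (w r).2 φ =
      ∫ τ in r..s, (pairing (w τ).1 (deriv (deriv φ)) + pairing h φ * u τ)

theorem continuous_deriv_deriv {φ : ℝ → ℝ} (hφ : ContDiff ℝ 2 φ) :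
    Continuous (deriv (deriv φ)) := by
  have h1 : ContDiff ℝ 1 (deriv φ) := ((contDiff_succ_iff_deriv (n := 1)).1 hφ).2.2
  exact h1.continuous_deriv le_rfl

/-- Two integrations by parts; the boundary terms vanish because both `φ` and `sin(mθ)` are zero at
`0` and `π`. -/
theorem sineCoeff_deriv_deriv {φ : ℝ → ℝ} (hφ : ContDiff ℝ 2 φ) (h0 : φ 0 = 0)
    (hπ : φ Real.pi = 0) (m : ℕ) :
    sineCoeff (contLp (deriv (deriv φ)) (continuous_deriv_deriv hφ)) m =
      -(m : ℝ) ^ 2 * sineCoeff (contLp φ hφ.continuous) m := by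
  have h1 : ContDiff ℝ 1 (deriv φ) := ((contDiff_succ_iff_deriv (n := 1)).1 hφ).2.2
  have h2 := continuous_deriv_deriv hφ
  have hF : ∀ x ∈ uIcc (0 : ℝ) Real.pi, HasDerivAt
      (fun θ => deriv φ θ * Real.sin (m * θ) - φ θ * (m * Real.cos (m * θ)))
      (deriv (deriv φ) x * Real.sin (m * x) + (m : ℝ) ^ 2 * (φ x * Real.sin (m * x))) x := by
    intro x _
    have d1 : HasDerivAt φ (deriv φ x) x :=
      (hφ.differentiable (by norm_num) x).hasDerivAt
    have d2 : HasDerivAt (deriv φ) (deriv (deriv φ) x) x :=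
      (h1.differentiable (by norm_num) x).hasDerivAt
    have d0 : HasDerivAt (fun θ : ℝ => (m : ℝ) * θ) m x := by
      simpa using (hasDerivAt_id x).const_mul (m : ℝ)
    have d3 := d0.sin
    have d4 := d0.cos.const_mul (m : ℝ)
    refine ((d2.mul d3).sub (d1.mul d4)).congr_deriv ?_
    ring
  have hφc := hφ.continuous
  have key := intervalIntegral.integral_eq_sub_of_hasDerivAt hF
    (Continuous.intervalIntegrable (by fun_prop) _ _)
  rw [intervalIntegral.integral_add (Continuous.intervalIntegrable (by fun_prop) _ _)
    (Continuous.intervalIntegrable (by fun_prop) _ _), intervalIntegral.integral_const_mul] at key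
  simp only [h0, hπ, Real.sin_nat_mul_pi, mul_zero, zero_mul, Real.sin_zero, sub_self] at key
  rw [sineCoeff, sineCoeff, pairing_contLp, pairing_contLp]
  linear_combination (2 / Real.pi) * key

theorem sineCoeff_intervalIntegral {f : ℝ → L2} (hf : Continuous f) (r s : ℝ) (m : ℕ) :
    sineCoeff (∫ τ in r..s, f τ) m = ∫ τ in r..s, sineCoeff (f τ) m := by
  simp only [sineCoeff_eq]
  exact ((sineCoeffL m).intervalIntegral_comp_comm (hf.intervalIntegrable r s)).symm

/-- The weak wave equation follows from the modal equations. -/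
theorem pairing_sub_eq_integral {h : L2} {u : ℝ → ℝ} (hu : Continuous u) {y v : ℝ → L2}
    (hy : Continuous y) {r s : ℝ}
    (hm : ∀ m : ℕ, sineCoeff (v s) m - sineCoeff (v r) m =
      ∫ τ in r..s, (-(m : ℝ) ^ 2 * sineCoeff (y τ) m + sineCoeff h m * u τ))
    {φ : ℝ → ℝ} (hφ : ContDiff ℝ 2 φ) (h0 : φ 0 = 0) (hπ : φ Real.pi = 0) :
    pairing (v s) φ - pairing (v r) φ =
      ∫ τ in r..s, (pairing (y τ) (deriv (deriv φ)) + pairing h φ * u τ) := by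
  have h2 := continuous_deriv_deriv hφ
  -- The modal equations say that `K` is formally `∂²/∂θ²` of `∫ y`. Parseval's identity moves the
  -- factors `-m²` onto `φ`, so `∫ y` itself need not be differentiated.
  set K : L2 := v s - v r - (∫ τ in r..s, u τ) • h with hK
  have hKm : ∀ m : ℕ, sineCoeff K m = -(m : ℝ) ^ 2 * sineCoeff (∫ τ in r..s, y τ) m := by
    intro m
    have hyc : Continuous fun τ => sineCoeff (y τ) m := by
      simp only [sineCoeff_eq]; exact (sineCoeffL m).continuous.comp hy
    rw [hK, sineCoeff_sub, sineCoeff_sub, sineCoeff_smul, hm, sineCoeff_intervalIntegral hy,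
      intervalIntegral.integral_add (Continuous.intervalIntegrable (by fun_prop) _ _)
      (Continuous.intervalIntegrable (by fun_prop) _ _), intervalIntegral.integral_const_mul,
      intervalIntegral.integral_const_mul]
    ring
  have h3 := hasSum_sineCoeff_mul (contLp φ hφ.continuous) K
  have h4 := hasSum_sineCoeff_mul (contLp (deriv (deriv φ)) h2) (∫ τ in r..s, y τ)
  have h5 : inner ℝ (contLp φ hφ.continuous) K =
      inner ℝ (contLp (deriv (deriv φ)) h2) (∫ τ in r..s, y τ) := by
    have h6 := h3.unique (h4.congr_fun fun m => by
      rw [hKm, sineCoeff_deriv_deriv hφ h0 hπ]; ring)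
    exact mul_left_cancel₀ (by positivity) h6
  have h7 : inner ℝ (contLp (deriv (deriv φ)) h2) (∫ τ in r..s, y τ) =
      ∫ τ in r..s, inner ℝ (contLp (deriv (deriv φ)) h2) (y τ) :=
    ((innerSL ℝ (contLp (deriv (deriv φ)) h2)).intervalIntegral_comp_comm
      (hy.intervalIntegrable r s)).symm
  rw [h7, hK, inner_sub_right, inner_sub_right, real_inner_smul_right] at h5
  simp only [pairing_eq_inner _ hφ.continuous, pairing_eq_inner _ h2]
  rw [intervalIntegral.integral_add (Continuous.intervalIntegrable (by fun_prop) _ _)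
      (Continuous.intervalIntegrable (by fun_prop) _ _), intervalIntegral.integral_const_mul]
  linarith

/-- A family of solutions of the modal equations with locally uniformly summable energies
is a trajectory. -/
theorem exists_trajectory_of_modes (h : L2) {u : ℝ → ℝ} (hu : Continuous u)
    (α β : ℕ → ℝ → ℝ) (hα0 : ∀ s, α 0 s = 0) (hβ0 : ∀ s, β 0 s = 0)
    (hα : ∀ m s, HasDerivAt (α m) (β m s) s)
    (hβ : ∀ m s, HasDerivAt (β m) (-(m : ℝ) ^ 2 * α m s + sineCoeff h m * u s) s)
    (hD : ∀ s : ℝ, ∃ D : ℕ → ℝ, Summable D ∧ ∀ᶠ r in 𝓝 s, ∀ m : ℕ,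
      (m : ℝ) ^ 2 * α m r ^ 2 + β m r ^ 2 ≤ D m) :
    ∃ w, IsTrajectory h u w ∧
      ∀ s m, sineCoeff (w s).1 m = α m s ∧ sineCoeff (w s).2 m = β m s := by
  have hsum : ∀ s, Summable fun m : ℕ => (m : ℝ) ^ 2 * α m s ^ 2 + β m s ^ 2 := by
    intro s
    obtain ⟨D, hDs, hDb⟩ := hD s
    exact Summable.of_nonneg_of_le (fun m => by positivity) hDb.self_of_nhds hDs
  have hαs : ∀ s, Summable fun m : ℕ => α m s ^ 2 := by
    refine fun s => Summable.of_nonneg_of_le (fun m => by positivity) (fun m => ?_) (hsum s)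
    rcases m with _ | m
    · simp [hα0, hβ0]
    · have h1 : (1 : ℝ) ≤ ((m + 1 : ℕ) : ℝ) ^ 2 := one_le_pow₀ (by simp)
      nlinarith [sq_nonneg (α (m + 1) s), sq_nonneg (β (m + 1) s)]
  have hβs : ∀ s, Summable fun m : ℕ => β m s ^ 2 := by
    refine fun s => Summable.of_nonneg_of_le (fun m => by positivity) (fun m => ?_) (hsum s)
    nlinarith [sq_nonneg (m * α m s)]
  choose y hy using fun s => exists_sineCoeff_eq (hαs s) (hα0 s)
  choose v hv using fun s => exists_sineCoeff_eq (hβs s) (hβ0 s)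
  have hαc : ∀ m, Continuous (α m) := fun m =>
    continuous_iff_continuousAt.2 fun s => (hα m s).continuousAt
  have hβc : ∀ m, Continuous (β m) := fun m =>
    continuous_iff_continuousAt.2 fun s => (hβ m s).continuousAt
  have hmem : ∀ s, ((y s, v s) : State) ∈ stateSpace := fun s =>
    (hsum s).congr fun m => by simp [energyTerm, hy, hv]
  have hcont : ∀ s, Tendsto (fun r => energyNorm ((y r, v r) - (y s, v s) : State))
      (𝓝 s) (𝓝 0) := by
    intro s
    obtain ⟨D, hDs, hDb⟩ := hD s
    have h1 : Tendsto (fun r => ∑' m, energyTerm ((y r, v r) - (y s, v s) : State) m) (𝓝 s)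
        (𝓝 (∑' _ : ℕ, (0 : ℝ))) := by
      -- The `4` comes from `(p - q)² ≤ 2p² + 2q²` with both energies at most `D m`.
      refine tendsto_tsum_of_dominated_convergence (bound := fun m => 4 * D m)
        (hDs.mul_left 4) (fun m => ?_) ?_
      · simp only [energyTerm, Prod.fst_sub, Prod.snd_sub, sineCoeff_sub, hy, hv]
        have h2 : Continuous fun r =>
            (m : ℝ) ^ 2 * (α m r - α m s) ^ 2 + (β m r - β m s) ^ 2 := by
          have := hαc m
          have := hβc m
          fun_prop
        simpa using h2.tendsto s
      · filter_upwards [hDb] with r hr m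
        rw [Real.norm_of_nonneg (energyTerm_nonneg _ _)]
        simp only [energyTerm, Prod.fst_sub, Prod.snd_sub, sineCoeff_sub, hy, hv]
        nlinarith [hr m, hDb.self_of_nhds m, sq_nonneg (m * (α m r + α m s)),
          sq_nonneg (β m r + β m s)]
    rw [tsum_zero] at h1
    have h3 := (Real.continuous_sqrt.tendsto 0).comp h1
    rwa [Real.sqrt_zero] at h3
  have hvc : Continuous v := by
    refine continuous_iff_continuousAt.2 fun s => tendsto_iff_norm_sub_tendsto_zero.2 ?_
    have h1 : ∀ r, ‖v r - v s‖ ≤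
        √(Real.pi / 2) * energyNorm ((y r, v r) - (y s, v s) : State) := fun r => by
      simpa only [Prod.snd_sub] using
        norm_snd_le_energyNorm (sub_mem_stateSpace (hmem r) (hmem s))
    refine squeeze_zero (fun _ => norm_nonneg _) h1 ?_
    simpa using (hcont s).const_mul (√(Real.pi / 2))
  -- Comparing coefficients shows that `y` is a primitive of the continuous `v`; its `L²` derivative
  -- then needs no termwise differentiation of a series.
  have hyi : ∀ s, y s = y 0 + ∫ τ in (0 : ℝ)..s, v τ := by
    refine fun s => ext_sineCoeff fun m => ?_
    rw [sineCoeff_add, sineCoeff_intervalIntegral hvc, hy, hy]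
    simp only [hv]
    rw [intervalIntegral.integral_eq_sub_of_hasDerivAt (fun x _ => hα m x)
      ((hβc m).intervalIntegrable _ _)]
    ring
  have hyd : ∀ s, HasDerivAt y (v s) s := by
    intro s
    have h1 : HasDerivAt (fun s => y 0 + ∫ τ in (0 : ℝ)..s, v τ) (v s) s :=
      (intervalIntegral.integral_hasDerivAt_right (hvc.intervalIntegrable _ _)
        hvc.stronglyMeasurable.stronglyMeasurableAtFilter hvc.continuousAt).const_add _
    rwa [← funext hyi] at h1
  have hyc : Continuous y := continuous_iff_continuousAt.2 fun s => (hyd s).continuousAt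
  refine ⟨fun s => (y s, v s), ⟨hmem, hcont, hyd, ?_⟩, fun s m => ⟨hy s m, hv s m⟩⟩
  intro r s φ hφ h0 hπ
  refine pairing_sub_eq_integral hu hyc (fun m => ?_) hφ h0 hπ
  simp only [hy, hv]
  have := hαc m
  exact (intervalIntegral.integral_eq_sub_of_hasDerivAt (fun x _ => hβ m x)
    (Continuous.intervalIntegrable (by fun_prop) _ _)).symm

/-! ### Duhamel formulas for the modes -/

/-- The modal displacement, times the frequency, of the trajectory through `(A, B)` at time `c`
with forcing `g u`. -/
def modalDisp (u : ℝ → ℝ) (c A B g m s : ℝ) : ℝ :=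
  m * A * Real.cos (m * (s - c)) + B * Real.sin (m * (s - c)) +
    g * (Real.sin (m * s) * (∫ τ in c..s, Real.cos (m * τ) * u τ) -
      Real.cos (m * s) * ∫ τ in c..s, Real.sin (m * τ) * u τ)

/-- The modal velocity of the trajectory through `(A, B)` at time `c` with forcing `g u`. -/
def modalVel (u : ℝ → ℝ) (c A B g m s : ℝ) : ℝ :=
  -(m * A * Real.sin (m * (s - c))) + B * Real.cos (m * (s - c)) +
    g * (Real.cos (m * s) * (∫ τ in c..s, Real.cos (m * τ) * u τ) +
      Real.sin (m * s) * ∫ τ in c..s, Real.sin (m * τ) * u τ)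

/-- Expanding `sin(m(s-τ))` and `cos(m(s-τ))` in Duhamel's formula leaves `s` only as an endpoint of
these integrals, so the fundamental theorem of calculus applies to them directly. -/
theorem hasDerivAt_modal_integrals {u : ℝ → ℝ} (hu : Continuous u) (c m s : ℝ) :
    HasDerivAt (fun s => ∫ τ in c..s, Real.cos (m * τ) * u τ) (Real.cos (m * s) * u s) s ∧
    HasDerivAt (fun s => ∫ τ in c..s, Real.sin (m * τ) * u τ) (Real.sin (m * s) * u s) s :=
  ⟨(Continuous.integral_hasStrictDerivAt (f := fun τ => Real.cos (m * τ) * u τ)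
      (by fun_prop) c s).hasDerivAt,
    (Continuous.integral_hasStrictDerivAt (f := fun τ => Real.sin (m * τ) * u τ)
      (by fun_prop) c s).hasDerivAt⟩

theorem hasDerivAt_modalDisp {u : ℝ → ℝ} (hu : Continuous u) (c A B g m s : ℝ) :
    HasDerivAt (modalDisp u c A B g m) (m * modalVel u c A B g m s) s := by
  obtain ⟨hc, hs⟩ := hasDerivAt_modal_integrals hu c m s
  have d0 : HasDerivAt (fun s : ℝ => m * (s - c)) m s := by
    simpa using ((hasDerivAt_id s).sub_const c).const_mul m
  have d1 : HasDerivAt (fun s : ℝ => m * s) m s := by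
    simpa using (hasDerivAt_id s).const_mul m
  refine (((d0.cos.const_mul (m * A)).add (d0.sin.const_mul B)).add
    (((d1.sin.mul hc).sub (d1.cos.mul hs)).const_mul g)).congr_deriv ?_
  unfold modalVel
  ring

theorem hasDerivAt_modalVel {u : ℝ → ℝ} (hu : Continuous u) (c A B g m s : ℝ) :
    HasDerivAt (modalVel u c A B g m) (-(m * modalDisp u c A B g m s) + g * u s) s := by
  obtain ⟨hc, hs⟩ := hasDerivAt_modal_integrals hu c m s
  have d0 : HasDerivAt (fun s : ℝ => m * (s - c)) m s := by
    simpa using ((hasDerivAt_id s).sub_const c).const_mul m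
  have d1 : HasDerivAt (fun s : ℝ => m * s) m s := by
    simpa using (hasDerivAt_id s).const_mul m
  refine (((d0.sin.const_mul (m * A)).neg.add (d0.cos.const_mul B)).add
    (((d1.cos.mul hc).add (d1.sin.mul hs)).const_mul g)).congr_deriv ?_
  unfold modalDisp
  linear_combination (g * u s) * Real.sin_sq_add_cos_sq (m * s)

/-- The bound is uniform in the frequency; together with square summability of the coefficients of
`h` it gives the summable majorant required by `exists_trajectory_of_modes`. -/
theorem exists_bound_modal_integrals {u : ℝ → ℝ} (hu : Continuous u) (c s : ℝ) :
    ∃ M, ∀ᶠ r in 𝓝 s, ∀ m : ℝ, |∫ τ in c..r, Real.cos (m * τ) * u τ| ≤ M ∧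
      |∫ τ in c..r, Real.sin (m * τ) * u τ| ≤ M := by
  set R := |c| + |s| + 1 with hR
  obtain ⟨K, hK⟩ := (isCompact_Icc (a := -R) (b := R)).exists_bound_of_continuousOn
    hu.continuousOn
  have hR0 : 0 ≤ R := by positivity
  have hK0 : 0 ≤ K := (norm_nonneg _).trans (hK 0 ⟨by linarith, hR0⟩)
  refine ⟨K * (2 * R), ?_⟩
  filter_upwards [Metric.ball_mem_nhds s one_pos] with r hr m
  rw [Metric.mem_ball, Real.dist_eq] at hr
  have hr' : |r| ≤ R := by
    have := abs_sub_abs_le_abs_sub r s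
    have := abs_nonneg c
    linarith
  have hc' : |c| ≤ R := by
    have := abs_nonneg s
    linarith
  have h1 : ∀ f : ℝ → ℝ, (∀ x, |f x| ≤ 1) → |∫ τ in c..r, f τ * u τ| ≤ K * (2 * R) := by
    intro f hf
    have h2 : ‖∫ τ in c..r, f τ * u τ‖ ≤ K * |r - c| := by
      refine intervalIntegral.norm_integral_le_of_norm_le_const fun x hx => ?_
      have hx' : x ∈ Icc (-R) R := by
        have := uIoc_subset_uIcc hx
        exact uIcc_subset_Icc (abs_le.1 hc') (abs_le.1 hr') this
      rw [norm_mul]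
      calc ‖f x‖ * ‖u x‖ ≤ 1 * K := mul_le_mul (hf x) (hK x hx') (norm_nonneg _) zero_le_one
        _ = K := one_mul K
    refine h2.trans (mul_le_mul_of_nonneg_left ?_ hK0)
    have := abs_sub r c
    linarith
  exact ⟨h1 _ fun x => Real.abs_cos_le_one _, h1 _ fun x => Real.abs_sin_le_one _⟩

theorem sq_modal_combination_le {a b g x y C S M : ℝ} (hx : |x| ≤ 1) (hy : |y| ≤ 1)
    (hC : |C| ≤ M) (hS : |S| ≤ M) {p q : ℝ} (hp : |p| ≤ 1) (hq : |q| ≤ 1) :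
    (a * x + b * y + g * (p * C + q * S)) ^ 2 ≤ 3 * (a ^ 2 + b ^ 2 + 4 * g ^ 2 * M ^ 2) := by
  have h1 : (a * x) ^ 2 ≤ a ^ 2 := by
    rw [mul_pow]
    exact mul_le_of_le_one_right (sq_nonneg a) ((sq_le_one_iff_abs_le_one x).2 hx)
  have h2 : (b * y) ^ 2 ≤ b ^ 2 := by
    rw [mul_pow]
    exact mul_le_of_le_one_right (sq_nonneg b) ((sq_le_one_iff_abs_le_one y).2 hy)
  have h3 : |p * C + q * S| ≤ 2 * M := by
    have h4 : |p * C| ≤ 1 * M := by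
      rw [abs_mul]; exact mul_le_mul hp hC (abs_nonneg _) zero_le_one
    have h5 : |q * S| ≤ 1 * M := by
      rw [abs_mul]; exact mul_le_mul hq hS (abs_nonneg _) zero_le_one
    have := abs_add_le (p * C) (q * S)
    linarith
  have h6 : (p * C + q * S) ^ 2 ≤ (2 * M) ^ 2 := sq_le_sq' (by linarith [abs_le.1 h3])
    (abs_le.1 h3).2
  have h7 : (g * (p * C + q * S)) ^ 2 ≤ 4 * g ^ 2 * M ^ 2 := by
    rw [mul_pow]
    nlinarith [mul_le_mul_of_nonneg_left h6 (sq_nonneg g)]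
  nlinarith [sq_nonneg (a * x - b * y), sq_nonneg (a * x - g * (p * C + q * S)),
    sq_nonneg (b * y - g * (p * C + q * S))]

/-- The trajectory of the wave equation through a state at a given time, with its modes. -/
theorem exists_trajectory (h : L2) {u : ℝ → ℝ} (hu : Continuous u) (c : ℝ) {z : State}
    (hz : z ∈ stateSpace) :
    ∃ w, IsTrajectory h u w ∧ w c = z ∧ ∀ s, ∀ m : ℕ,
      m * sineCoeff (w s).1 m =
        modalDisp u c (sineCoeff z.1 m) (sineCoeff z.2 m) (sineCoeff h m) m s ∧
      sineCoeff (w s).2 m =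
        modalVel u c (sineCoeff z.1 m) (sineCoeff z.2 m) (sineCoeff h m) m s := by
  set P : ℕ → ℝ → ℝ := fun m =>
    modalDisp u c (sineCoeff z.1 m) (sineCoeff z.2 m) (sineCoeff h m) m with hP
  set V : ℕ → ℝ → ℝ := fun m =>
    modalVel u c (sineCoeff z.1 m) (sineCoeff z.2 m) (sineCoeff h m) m with hV
  have hP0 : ∀ s, P 0 s = 0 := fun s => by simp [hP, modalDisp]
  have hV0 : ∀ s, V 0 s = 0 := fun s => by simp [hV, modalVel]
  have hmP : ∀ (m : ℕ) s, (m : ℝ) * (P m s / m) = P m s := by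
    intro m s
    rcases m with _ | m
    · simp [hP0]
    · have : ((m + 1 : ℕ) : ℝ) ≠ 0 := by positivity
      field_simp
  -- For `m = 0` division by zero gives the required value `0`.
  obtain ⟨w, hw, hwm⟩ := exists_trajectory_of_modes h hu (fun m s => P m s / m) V
    (fun s => by simp) hV0
    (fun m s => by
      refine ((hasDerivAt_modalDisp hu c _ _ _ m s).div_const (m : ℝ)).congr_deriv ?_
      rcases m with _ | m
      · simp [hV0]
      · have : ((m + 1 : ℕ) : ℝ) ≠ 0 := by positivity
        field_simp
        rfl)
    (fun m s => by
      refine (hasDerivAt_modalVel hu c _ _ _ m s).congr_deriv ?_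
      rw [sq, neg_mul, mul_assoc, hmP])
    (fun s => by
      obtain ⟨M, hM⟩ := exists_bound_modal_integrals hu c s
      -- The sum of two bounds `3(a² + b² + 4g²M²)`, one for displacement and one for velocity.
      refine ⟨fun m => 6 * energyTerm z m + 24 * M ^ 2 * sineCoeff h m ^ 2,
        (hz.mul_left 6).add ((summable_sineCoeff_sq h).mul_left (24 * M ^ 2)), ?_⟩
      filter_upwards [hM] with r hr m
      obtain ⟨hC, hS⟩ := hr m
      have h1 := sq_modal_combination_le (a := m * sineCoeff z.1 m) (b := sineCoeff z.2 m)
        (g := sineCoeff h m) (Real.abs_cos_le_one (m * (r - c)))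
        (Real.abs_sin_le_one (m * (r - c))) hC hS (Real.abs_sin_le_one (m * r))
        (q := -Real.cos (m * r)) (by rw [abs_neg]; exact Real.abs_cos_le_one _)
      have h2 := sq_modal_combination_le (a := m * sineCoeff z.1 m) (b := sineCoeff z.2 m)
        (g := sineCoeff h m) (x := -Real.sin (m * (r - c)))
        (by rw [abs_neg]; exact Real.abs_sin_le_one _)
        (Real.abs_cos_le_one (m * (r - c))) hC hS (Real.abs_cos_le_one (m * r))
        (Real.abs_sin_le_one (m * r))
      have e1 : (m : ℝ) ^ 2 * (P m r / m) ^ 2 = (m * sineCoeff z.1 m * Real.cos (m * (r - c)) +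
          sineCoeff z.2 m * Real.sin (m * (r - c)) + sineCoeff h m *
          (Real.sin (m * r) * (∫ τ in c..r, Real.cos (m * τ) * u τ) +
          -Real.cos (m * r) * ∫ τ in c..r, Real.sin (m * τ) * u τ)) ^ 2 := by
        rw [← mul_pow, hmP]
        simp only [hP, modalDisp]
        ring
      have e2 : V m r ^ 2 = (m * sineCoeff z.1 m * -Real.sin (m * (r - c)) +
          sineCoeff z.2 m * Real.cos (m * (r - c)) + sineCoeff h m *
          (Real.cos (m * r) * (∫ τ in c..r, Real.cos (m * τ) * u τ) +
          Real.sin (m * r) * ∫ τ in c..r, Real.sin (m * τ) * u τ)) ^ 2 := by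
        simp only [hV, modalVel]
        ring
      rw [e1, e2, energyTerm]
      refine (add_le_add h1 h2).trans (le_of_eq ?_)
      ring)
  have hmodes : ∀ s, ∀ m : ℕ, m * sineCoeff (w s).1 m = P m s ∧ sineCoeff (w s).2 m = V m s :=
    fun s m => ⟨by rw [(hwm s m).1, hmP], (hwm s m).2⟩
  refine ⟨w, hw, ?_, hmodes⟩
  refine Prod.ext (ext_sineCoeff fun m => ?_) (ext_sineCoeff fun m => ?_)
  · rcases m with _ | m
    · simp
    · have h1 := (hmodes c (m + 1)).1
      simp only [hP, modalDisp, sub_self, mul_zero, Real.cos_zero, Real.sin_zero,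
        intervalIntegral.integral_same, mul_one, add_zero] at h1
      exact mul_left_cancel₀ (by positivity) h1
  · have h1 := (hmodes c m).2
    simpa [hV, modalVel] using h1

/-! ### Superposition and impulses -/

theorem IsTrajectory.continuous_fst {h : L2} {u : ℝ → ℝ} {w : ℝ → State}
    (hw : IsTrajectory h u w) : Continuous fun s => (w s).1 :=
  continuous_iff_continuousAt.2 fun s => (hw.velocity s).continuousAt

theorem continuous_pairing {f : ℝ → L2} (hf : Continuous f) {φ : ℝ → ℝ} (hφ : Continuous φ) :
    Continuous fun s => pairing (f s) φ := by
  simp only [pairing_eq_inner _ hφ]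
  fun_prop

theorem pairing_add_left (f g : L2) {φ : ℝ → ℝ} (hφ : Continuous φ) :
    pairing (f + g) φ = pairing f φ + pairing g φ := by
  simp only [pairing_eq_inner _ hφ, inner_add_right]

/-- Adding an unforced trajectory to a trajectory. -/
theorem IsTrajectory.add {h : L2} {u : ℝ → ℝ} (hu : Continuous u) {w v : ℝ → State}
    (hw : IsTrajectory h u w) (hv : IsTrajectory h (fun _ => 0) v) :
    IsTrajectory h u (fun s => w s + v s) where
  mem s := add_mem_stateSpace (hw.mem s) (hv.mem s)
  cont s := by
    simp only [add_sub_add_comm]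
    exact tendsto_energyNorm_add
      (Eventually.of_forall fun r => sub_mem_stateSpace (hw.mem r) (hw.mem s))
      (Eventually.of_forall fun r => sub_mem_stateSpace (hv.mem r) (hv.mem s))
      (hw.cont s) (hv.cont s)
  velocity s := (hw.velocity s).add (hv.velocity s)
  wave r s φ hφ h0 hπ := by
    have h1 := hw.wave r s φ hφ h0 hπ
    have h2 := hv.wave r s φ hφ h0 hπ
    have h3 := continuous_deriv_deriv hφ
    have h4 := continuous_pairing hw.continuous_fst h3
    have h5 := continuous_pairing hv.continuous_fst h3
    simp only [Prod.snd_add, Prod.fst_add, pairing_add_left _ _ hφ.continuous,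
      pairing_add_left _ _ h3]
    rw [add_sub_add_comm, h1, h2, ← intervalIntegral.integral_add
      (Continuous.intervalIntegrable (by fun_prop) _ _)
      (Continuous.intervalIntegrable (by fun_prop) _ _)]
    refine intervalIntegral.integral_congr fun τ _ => ?_
    ring

theorem IsTrajectory.add_sum {h : L2} {u : ℝ → ℝ} (hu : Continuous u) {ι : Type*}
    {w : ℝ → State} {W : ι → ℝ → State} (hw : IsTrajectory h u w)
    (hW : ∀ i, IsTrajectory h (fun _ => 0) (W i)) (I : Finset ι) :
    IsTrajectory h u (fun s => w s + ∑ i ∈ I, W i s) := by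
  classical
  induction I using Finset.induction_on with
  | empty => simpa using hw
  | insert i I hi ih =>
    have h1 := ih.add hu (hW i)
    convert h1 using 2 with s
    rw [Finset.sum_insert hi]
    abel

/-- The trajectory `w` with the trajectory `W i` superposed after the time `τ i`. -/
def superpose {p : ℕ} (τ : Fin p → ℝ) (w : ℝ → State) (W : Fin p → ℝ → State) (s : ℝ) : State :=
  w s + ∑ i with τ i < s, W i s

section Superpose

variable {p : ℕ} {τ : Fin p → ℝ} {w : ℝ → State} {W : Fin p → ℝ → State} {h : L2} {u : ℝ → ℝ}

/-- The strict inequality in `superpose` keeps the set of active impulses constant just before and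
at `s`, whence left continuity. Just after `s` the condition becomes `τ i ≤ s`, which produces the
jump. -/
theorem superpose_eventuallyEq_left (s : ℝ) :
    superpose τ w W =ᶠ[𝓝[<] s] fun r => w r + ∑ i with τ i < s, W i r := by
  have h1 : ∀ᶠ r in 𝓝[<] s, ∀ i, τ i < r ↔ τ i < s := by
    rw [eventually_all]
    intro i
    by_cases hi : τ i < s
    · filter_upwards [Ioo_mem_nhdsLT hi] with r hr
      simp [hr.1, hi]
    · filter_upwards [self_mem_nhdsWithin] with r hr
      have : r < s := hr
      simp only [hi, iff_false]
      linarith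
  filter_upwards [h1] with r hr
  simp only [superpose, hr]

theorem superpose_eventuallyEq_right (s : ℝ) :
    superpose τ w W =ᶠ[𝓝[>] s] fun r => w r + ∑ i with τ i ≤ s, W i r := by
  have h1 : ∀ᶠ r in 𝓝[>] s, ∀ i, τ i < r ↔ τ i ≤ s := by
    rw [eventually_all]
    intro i
    by_cases hi : τ i ≤ s
    · filter_upwards [self_mem_nhdsWithin] with r hr
      have : s < r := hr
      simp only [hi, iff_true]
      linarith
    · filter_upwards [Ioo_mem_nhdsGT (not_le.1 hi)] with r hr
      simp only [hi, iff_false, not_lt]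
      exact hr.2.le
  filter_upwards [h1] with r hr
  simp only [superpose, hr]

theorem tendsto_superpose_left (hu : Continuous u) (hw : IsTrajectory h u w)
    (hW : ∀ i, IsTrajectory h (fun _ => 0) (W i)) (s : ℝ) :
    Tendsto (fun r => energyNorm (superpose τ w W r - superpose τ w W s)) (𝓝[<] s) (𝓝 0) := by
  refine (((hw.add_sum hu hW {i | τ i < s}).cont s).mono_left nhdsWithin_le_nhds).congr' ?_
  filter_upwards [superpose_eventuallyEq_left s] with r hr
  rw [hr]
  rfl

theorem tendsto_superpose_right (hu : Continuous u) (hw : IsTrajectory h u w)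
    (hW : ∀ i, IsTrajectory h (fun _ => 0) (W i)) (s : ℝ) :
    Tendsto (fun r => energyNorm (superpose τ w W r - (w s + ∑ i with τ i ≤ s, W i s)))
      (𝓝[>] s) (𝓝 0) := by
  refine (((hw.add_sum hu hW {i | τ i ≤ s}).cont s).mono_left nhdsWithin_le_nhds).congr' ?_
  filter_upwards [superpose_eventuallyEq_right s] with r hr
  rw [hr]

end Superpose

/-- No impulse time lies strictly between consecutive nodes, so the set of active summands is
constant there. -/
theorem impulse_lt_iff {p : ℕ} {t : Fin (p + 2) → ℝ} (ht : StrictMono t) {k : Fin (p + 1)}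
    {r s : ℝ} (hr : r ∈ Ioo (t k.castSucc) (t k.succ)) (hs : s ∈ Ioo (t k.castSucc) (t k.succ))
    (i : Fin p) : t i.castSucc.succ < r ↔ t i.castSucc.succ < s := by
  rcases le_or_gt i.castSucc.succ k.castSucc with hi | hi
  · have := ht.monotone hi
    exact ⟨fun _ => this.trans_lt hs.1, fun _ => this.trans_lt hr.1⟩
  · have := ht.monotone (Fin.castSucc_lt_iff_succ_le.1 hi)
    exact ⟨fun h => absurd (h.trans hr.2) this.not_gt, fun h => absurd (h.trans hs.2) this.not_gt⟩

theorem isSolution_superpose {p : ℕ} {t : Fin (p + 2) → ℝ} (ht : StrictMono t) {h : L2}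
    {J : Fin p → State} {z₀ : State} {u : ℝ → ℝ} (hu : Continuous u) {w : ℝ → State}
    {W : Fin p → ℝ → State} (hw : IsTrajectory h u w) (hw0 : w (t 0) = z₀)
    (hW : ∀ i, IsTrajectory h (fun _ => 0) (W i)) (hWJ : ∀ i, W i (t i.castSucc.succ) = J i) :
    IsSolution t h J z₀ u (superpose (fun i => t i.castSucc.succ) w W) where
  mem s _ := (hw.add_sum hu hW _).mem s
  init := by
    have h1 : ∀ i : Fin p, ¬ t i.castSucc.succ < t 0 := fun i =>
      (ht.monotone (Fin.zero_le _)).not_gt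
    simp [superpose, h1, hw0]
  left_cont s _ := tendsto_superpose_left hu hw hW s
  right_cont s _ hs := by
    have h1 := tendsto_superpose_right (τ := fun i => t i.castSucc.succ) hu hw hW s
    have h2 : ∀ i : Fin p, t i.castSucc.succ ≤ s ↔ t i.castSucc.succ < s := fun i =>
      ⟨fun h => h.lt_of_ne' (hs i), le_of_lt⟩
    simp only [h2] at h1
    exact h1
  jump i := by
    have h1 := tendsto_superpose_right (τ := fun i => t i.castSucc.succ) hu hw hW
      (t i.castSucc.succ)
    -- The two active sets differ by `i` alone, whose summand equals `J i` at this time.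
    have h2 : ({j | t j.castSucc.succ ≤ t i.castSucc.succ} : Finset (Fin p)) =
        insert i ({j | t j.castSucc.succ < t i.castSucc.succ} : Finset (Fin p)) := by
      ext j
      simp only [ht.le_iff_le, ht.lt_iff_lt, Finset.mem_insert, Finset.mem_filter,
        Finset.mem_univ, true_and, Fin.succ_le_succ_iff, Fin.succ_lt_succ_iff,
        Fin.castSucc_le_castSucc_iff, Fin.castSucc_lt_castSucc_iff]
      exact le_iff_eq_or_lt
    have h3 : superpose (fun i => t i.castSucc.succ) w W (t i.castSucc.succ) + J i =
        w (t i.castSucc.succ) +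
          ∑ j with t j.castSucc.succ ≤ t i.castSucc.succ, W j (t i.castSucc.succ) := by
      rw [h2, Finset.sum_insert (by simp), hWJ, superpose]
      abel
    rw [h3]
    exact h1
  velocity k s hs := by
    have h1 := (hw.add_sum hu hW {i | t i.castSucc.succ < s}).velocity s
    refine h1.congr_of_eventuallyEq ?_
    filter_upwards [Ioo_mem_nhds hs.1 hs.2] with r hr
    simp only [superpose, impulse_lt_iff ht hr hs]
  wave k r hr s hs φ hφ h0 hπ := by
    have h1 := (hw.add_sum hu hW {i | t i.castSucc.succ < s}).wave r s φ hφ h0 hπ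
    simp only [superpose, impulse_lt_iff ht hr hs]
    rw [h1]
    refine intervalIntegral.integral_congr fun τ hτ => ?_
    have hτ' : τ ∈ Ioo (t k.castSucc) (t k.succ) := ordConnected_Ioo.uIcc_subset hr hs hτ
    simp only [impulse_lt_iff ht hτ' hs]

/-! ### Uniqueness of the final state -/

theorem continuousOn_Icc_of_tendsto {f : ℝ → ℝ} {A B : ℝ}
    (hl : ∀ s ∈ Ioc A B, Tendsto f (𝓝[<] s) (𝓝 (f s)))
    (hr : ∀ s ∈ Ico A B, Tendsto f (𝓝[>] s) (𝓝 (f s))) : ContinuousOn f (Icc A B) := by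
  intro s hs
  have h1 : ContinuousWithinAt f (Icc A s) s := by
    rcases hs.1.eq_or_lt with rfl | h
    · simp
    · exact (continuousWithinAt_Iio_iff_Iic.1 (hl s ⟨h, hs.2⟩)).mono Icc_subset_Iic_self
  have h2 : ContinuousWithinAt f (Icc s B) s := by
    rcases hs.2.eq_or_lt with rfl | h
    · simp
    · exact (continuousWithinAt_Ioi_iff_Ici.1 (hr s ⟨hs.1, h⟩)).mono Icc_subset_Ici_self
  rw [← Icc_union_Icc_eq_Icc hs.1 hs.2]
  exact h1.union h2

theorem exists_mem_Ioo_of_forall_ne {p : ℕ} {t : Fin (p + 2) → ℝ} {s : ℝ}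
    (hs : s ∈ Ioo (t 0) (t (Fin.last (p + 1)))) (hsi : ∀ i : Fin p, s ≠ t i.castSucc.succ) :
    ∃ k : Fin (p + 1), s ∈ Ioo (t k.castSucc) (t k.succ) := by
  by_contra! hk
  -- If `s` lay in no open interval, induction over the nodes would place even the last node before
  -- `s`.
  have h1 : ∀ j : Fin (p + 2), t j < s := by
    intro j
    induction j using Fin.induction with
    | zero => exact hs.1
    | succ k ih =>
      have h2 : t k.succ ≤ s := not_lt.1 fun h => hk k ⟨ih, h⟩
      refine h2.lt_of_ne ?_
      induction k using Fin.lastCases with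
      | last => rw [Fin.succ_last]; exact fun h => hs.2.ne h.symm
      | cast i => exact fun h => hsi i h.symm
  exact absurd (h1 _) hs.2.not_gt

namespace IsSolution

variable {p : ℕ} {t : Fin (p + 2) → ℝ} {h : L2} {J : Fin p → State} {z₀ : State} {u : ℝ → ℝ}
  {x x' : ℝ → State}

theorem hasDerivAt_fst (hx : IsSolution t h J z₀ u x) {k : Fin (p + 1)} {s : ℝ}
    (hs : s ∈ Ioo (t k.castSucc) (t k.succ)) (m : ℕ) :
    HasDerivAt (fun r => sineCoeff (x r).1 m) (sineCoeff (x s).2 m) s := by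
  simp only [sineCoeff_eq]
  exact (sineCoeffL m).hasFDerivAt.comp_hasDerivAt s (hx.velocity k s hs)

theorem deriv_deriv_sin_mul (m : ℝ) :
    deriv (deriv fun θ : ℝ => Real.sin (m * θ)) = fun θ => -m ^ 2 * Real.sin (m * θ) := by
  have d0 : ∀ θ : ℝ, HasDerivAt (fun θ : ℝ => m * θ) m θ := fun θ => by
    simpa using (hasDerivAt_id θ).const_mul m
  have h1 : (deriv fun θ : ℝ => Real.sin (m * θ)) = fun θ => Real.cos (m * θ) * m :=
    funext fun θ => (d0 θ).sin.deriv
  rw [h1]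
  funext θ
  rw [((d0 θ).cos.mul_const m).deriv]
  ring

/-- The weak equation is tested with `sin(mθ)`, an eigenfunction of the Dirichlet Laplacian;
continuity of `u` upgrades the integral identity to a pointwise derivative. -/
theorem hasDerivAt_snd (hx : IsSolution t h J z₀ u x) (hu : Continuous u) {k : Fin (p + 1)}
    {s : ℝ} (hs : s ∈ Ioo (t k.castSucc) (t k.succ)) (m : ℕ) :
    HasDerivAt (fun r => sineCoeff (x r).2 m)
      (-(m : ℝ) ^ 2 * sineCoeff (x s).1 m + sineCoeff h m * u s) s := by
  have h1 : ContinuousOn (fun r => -(m : ℝ) ^ 2 * sineCoeff (x r).1 m + sineCoeff h m * u r)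
      (Ioo (t k.castSucc) (t k.succ)) := by
    intro r hr
    exact ((continuousAt_const.mul (hx.hasDerivAt_fst hr m).continuousAt).add
      (continuousAt_const.mul hu.continuousAt)).continuousWithinAt
  have h2 : HasDerivAt (fun r => sineCoeff (x s).2 m +
      ∫ τ in s..r, (-(m : ℝ) ^ 2 * sineCoeff (x τ).1 m + sineCoeff h m * u τ))
      (-(m : ℝ) ^ 2 * sineCoeff (x s).1 m + sineCoeff h m * u s) s :=
    (intervalIntegral.integral_hasDerivAt_right IntervalIntegrable.refl
      (h1.stronglyMeasurableAtFilter isOpen_Ioo s hs)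
      (h1.continuousAt (Ioo_mem_nhds hs.1 hs.2))).const_add _
  refine h2.congr_of_eventuallyEq ?_
  filter_upwards [Ioo_mem_nhds hs.1 hs.2] with r hr
  have h3 := hx.wave k s hs r hr (fun θ => Real.sin (m * θ)) (by fun_prop) (by simp)
    (Real.sin_nat_mul_pi m)
  rw [deriv_deriv_sin_mul] at h3
  simp only [pairing_const_mul_right] at h3
  have h4 : ∫ τ in s..r, (-(m : ℝ) ^ 2 * sineCoeff (x τ).1 m + sineCoeff h m * u τ) =
      2 / Real.pi * (pairing (x r).2 (fun θ => Real.sin (m * θ)) -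
        pairing (x s).2 (fun θ => Real.sin (m * θ))) := by
    rw [h3, ← intervalIntegral.integral_const_mul]
    refine intervalIntegral.integral_congr fun τ _ => ?_
    simp only [sineCoeff]
    ring
  rw [h4]
  simp only [sineCoeff]
  ring

theorem tendsto_sub_left (hx : IsSolution t h J z₀ u x) (hx' : IsSolution t h J z₀ u x') {s : ℝ}
    (hs : s ∈ Ioc (t 0) (t (Fin.last (p + 1)))) :
    Tendsto (fun r => energyNorm ((x r - x' r) - (x s - x' s))) (𝓝[<] s) (𝓝 0) := by
  have hs' := Ioc_subset_Icc_self hs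
  have h1 : ∀ᶠ r in 𝓝[<] s, r ∈ Icc (t 0) (t (Fin.last (p + 1))) := by
    filter_upwards [Ioo_mem_nhdsLT hs.1] with r hr using ⟨hr.1.le, hr.2.le.trans hs.2⟩
  have h2 := tendsto_energyNorm_add (z := fun r => x r - x s) (w := fun r => x' s - x' r)
    (h1.mono fun r hr => sub_mem_stateSpace (hx.mem r hr) (hx.mem s hs'))
    (h1.mono fun r hr => sub_mem_stateSpace (hx'.mem s hs') (hx'.mem r hr))
    (hx.left_cont s hs) (by
      simp only [energyNorm_sub_comm (x' s)]
      exact hx'.left_cont s hs)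
  refine h2.congr fun r => ?_
  congr 1
  abel

/-- Both solutions have the same jumps, which cancel in the difference. Membership of `J i` in
`stateSpace` is needed because `energyNorm` takes the junk value `0` on divergent sums. -/
theorem tendsto_sub_right (hx : IsSolution t h J z₀ u x) (hx' : IsSolution t h J z₀ u x')
    (hJ : ∀ i, J i ∈ stateSpace) {s : ℝ} (hs : s ∈ Ico (t 0) (t (Fin.last (p + 1)))) :
    Tendsto (fun r => energyNorm ((x r - x' r) - (x s - x' s))) (𝓝[>] s) (𝓝 0) := by
  have hs' := Ico_subset_Icc_self hs
  have h1 : ∀ᶠ r in 𝓝[>] s, r ∈ Icc (t 0) (t (Fin.last (p + 1))) := by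
    filter_upwards [Ioo_mem_nhdsGT hs.2] with r hr using ⟨hs.1.trans hr.1.le, hr.2.le⟩
  obtain ⟨j, hj, hxj, hxj'⟩ : ∃ j ∈ stateSpace,
      Tendsto (fun r => energyNorm (x r - (x s + j))) (𝓝[>] s) (𝓝 0) ∧
      Tendsto (fun r => energyNorm (x' r - (x' s + j))) (𝓝[>] s) (𝓝 0) := by
    by_cases hi : ∃ i : Fin p, s = t i.castSucc.succ
    · obtain ⟨i, rfl⟩ := hi
      exact ⟨J i, hJ i, hx.jump i, hx'.jump i⟩
    · push Not at hi
      refine ⟨0, zero_mem_stateSpace, ?_⟩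
      simp only [add_zero]
      exact ⟨hx.right_cont s hs hi, hx'.right_cont s hs hi⟩
  have h2 := tendsto_energyNorm_add (z := fun r => x r - (x s + j))
    (w := fun r => (x' s + j) - x' r)
    (h1.mono fun r hr => sub_mem_stateSpace (hx.mem r hr) (add_mem_stateSpace (hx.mem s hs') hj))
    (h1.mono fun r hr =>
      sub_mem_stateSpace (add_mem_stateSpace (hx'.mem s hs') hj) (hx'.mem r hr))
    hxj (by
      simp only [energyNorm_sub_comm (x' s + j)]
      exact hxj')
  refine h2.congr fun r => ?_
  congr 1
  abel

theorem tendsto_of_abs_sub_le {l : Filter ℝ} {f g : ℝ → ℝ} {a : ℝ}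
    (hfg : ∀ᶠ r in l, |f r - a| ≤ g r) (hg : Tendsto g l (𝓝 0)) : Tendsto f l (𝓝 a) := by
  rw [tendsto_iff_norm_sub_tendsto_zero]
  exact squeeze_zero' (Eventually.of_forall fun _ => norm_nonneg _) hfg hg

/-- The difference solves the free equation without jumps, so its `m`-th modal energy is continuous
on the whole interval, has derivative zero off the impulse times, and starts at zero. -/
theorem energyTerm_sub_last_eq_zero (hx : IsSolution t h J z₀ u x) (hx' : IsSolution t h J z₀ u x')
    (hu : Continuous u) (hJ : ∀ i, J i ∈ stateSpace) (h0 : t 0 ≤ t (Fin.last (p + 1))) (m : ℕ) :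
    energyTerm (x (t (Fin.last (p + 1))) - x' (t (Fin.last (p + 1)))) m = 0 := by
  set A := t 0
  set B := t (Fin.last (p + 1))
  have hmem : ∀ s ∈ Icc A B, x s - x' s ∈ stateSpace := fun s hs =>
    sub_mem_stateSpace (hx.mem s hs) (hx'.mem s hs)
  have hl : ∀ s ∈ Ioc A B, ∀ᶠ r in 𝓝[<] s, (x r - x' r) - (x s - x' s) ∈ stateSpace := by
    intro s hs
    filter_upwards [Ioo_mem_nhdsLT hs.1] with r hr
    exact sub_mem_stateSpace (hmem r ⟨hr.1.le, hr.2.le.trans hs.2⟩) (hmem s ⟨hs.1.le, hs.2⟩)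
  have hr : ∀ s ∈ Ico A B, ∀ᶠ r in 𝓝[>] s, (x r - x' r) - (x s - x' s) ∈ stateSpace := by
    intro s hs
    filter_upwards [Ioo_mem_nhdsGT hs.2] with r hr
    exact sub_mem_stateSpace (hmem r ⟨hs.1.trans hr.1.le, hr.2.le⟩) (hmem s ⟨hs.1, hs.2.le⟩)
  have hc1 : ContinuousOn (fun s => sineCoeff (x s - x' s).1 m) (Icc A B) := by
    refine continuousOn_Icc_of_tendsto (fun s hs => ?_) fun s hs => ?_
    · refine tendsto_of_abs_sub_le ((hl s hs).mono fun r hr => ?_) (hx.tendsto_sub_left hx' hs)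
      simpa only [Prod.fst_sub, sineCoeff_sub] using abs_sineCoeff_fst_le hr m
    · refine tendsto_of_abs_sub_le ((hr s hs).mono fun r hr => ?_)
        (hx.tendsto_sub_right hx' hJ hs)
      simpa only [Prod.fst_sub, sineCoeff_sub] using abs_sineCoeff_fst_le hr m
  have hc2 : ContinuousOn (fun s => sineCoeff (x s - x' s).2 m) (Icc A B) := by
    refine continuousOn_Icc_of_tendsto (fun s hs => ?_) fun s hs => ?_
    · refine tendsto_of_abs_sub_le ((hl s hs).mono fun r hr => ?_) (hx.tendsto_sub_left hx' hs)
      simpa only [Prod.snd_sub, sineCoeff_sub] using abs_sineCoeff_snd_le hr m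
    · refine tendsto_of_abs_sub_le ((hr s hs).mono fun r hr => ?_)
        (hx.tendsto_sub_right hx' hJ hs)
      simpa only [Prod.snd_sub, sineCoeff_sub] using abs_sineCoeff_snd_le hr m
  have hc : ContinuousOn (fun s => energyTerm (x s - x' s) m) (Icc A B) :=
    (continuousOn_const.mul (hc1.pow 2)).add (hc2.pow 2)
  have hd : ∀ s ∈ Ioo A B \ range (fun i : Fin p => t i.castSucc.succ),
      HasDerivAt (fun s => energyTerm (x s - x' s) m) 0 s := by
    rintro s ⟨hs, hsi⟩
    obtain ⟨k, hk⟩ := exists_mem_Ioo_of_forall_ne hs fun i hi => hsi ⟨i, hi.symm⟩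
    have d1 := (hx.hasDerivAt_fst hk m).sub (hx'.hasDerivAt_fst hk m)
    have d2 := (hx.hasDerivAt_snd hu hk m).sub (hx'.hasDerivAt_snd hu hk m)
    have d3 := ((d1.pow 2).const_mul ((m : ℝ) ^ 2)).add (d2.pow 2)
    simp only [energyTerm, Prod.fst_sub, Prod.snd_sub, sineCoeff_sub]
    refine d3.congr_deriv ?_
    simp only [Pi.sub_apply]
    push_cast
    ring
  have h3 := integral_eq_of_hasDerivAt_off_countable_of_le
    (fun s => energyTerm (x s - x' s) m) (fun _ => 0) h0 (countable_range _) hc hd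
    intervalIntegrable_const
  simp only [intervalIntegral.integral_zero] at h3
  rw [sub_eq_zero.1 h3.symm]
  simp [A, hx.init, hx'.init]

/-- The final state is determined by the data. -/
theorem last_unique (hx : IsSolution t h J z₀ u x) (hx' : IsSolution t h J z₀ u x')
    (hu : Continuous u) (hJ : ∀ i, J i ∈ stateSpace) (h0 : t 0 ≤ t (Fin.last (p + 1))) :
    x (t (Fin.last (p + 1))) = x' (t (Fin.last (p + 1))) := by
  have h1 : ∀ m, sineCoeff (x (t (Fin.last (p + 1)))).1 m =
        sineCoeff (x' (t (Fin.last (p + 1)))).1 m ∧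
      sineCoeff (x (t (Fin.last (p + 1)))).2 m = sineCoeff (x' (t (Fin.last (p + 1)))).2 m := by
    intro m
    have h2 := hx.energyTerm_sub_last_eq_zero hx' hu hJ h0 m
    simp only [energyTerm, Prod.fst_sub, Prod.snd_sub, sineCoeff_sub] at h2
    rcases m with _ | m
    · simp
    · obtain ⟨h3, h4⟩ := (add_eq_zero_iff_of_nonneg (by positivity) (by positivity)).1 h2
      rw [mul_eq_zero, or_iff_right (by positivity), sq_eq_zero_iff, sub_eq_zero] at h3
      rw [sq_eq_zero_iff, sub_eq_zero] at h4
      exact ⟨h3, h4⟩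
  exact Prod.ext (ext_sineCoeff fun m => (h1 m).1) (ext_sineCoeff fun m => (h1 m).2)

end IsSolution

/-! ### Trigonometric polynomials on `[0, 2π]` as controls -/

theorem integral_cos_int_mul_two_pi (k : ℤ) :
    ∫ θ in (0 : ℝ)..2 * Real.pi, Real.cos (k * θ) = if k = 0 then 2 * Real.pi else 0 := by
  split_ifs with hk
  · simp [hk]
  · have h1 : (k : ℝ) ≠ 0 := by exact_mod_cast hk
    have h2 : Real.sin (k * (2 * Real.pi)) = 0 := by
      have := Real.sin_int_mul_pi (k * 2)
      rwa [Int.cast_mul, Int.cast_ofNat, mul_assoc] at this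
    rw [intervalIntegral.integral_comp_mul_left (fun x => Real.cos x) h1]
    simp [h2]

theorem integral_sin_int_mul_two_pi (k : ℤ) :
    ∫ θ in (0 : ℝ)..2 * Real.pi, Real.sin (k * θ) = 0 := by
  rcases eq_or_ne k 0 with rfl | hk
  · simp
  · have h1 : (k : ℝ) ≠ 0 := by exact_mod_cast hk
    rw [intervalIntegral.integral_comp_mul_left (fun x => Real.sin x) h1]
    simp [Real.cos_int_mul_two_pi]

section Orthogonality

variable {m j : ℕ}

theorem integral_sin_mul_sin_two_pi (hm : 1 ≤ m) :
    ∫ θ in (0 : ℝ)..2 * Real.pi, Real.sin (m * θ) * Real.sin (j * θ) =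
      if j = m then Real.pi else 0 := by
  have h1 : ∀ θ : ℝ, Real.sin (m * θ) * Real.sin (j * θ) =
      (1 / 2) * (Real.cos (((m - j : ℤ) : ℝ) * θ) - Real.cos (((m + j : ℤ) : ℝ) * θ)) := by
    intro θ
    push_cast
    rw [sub_mul, add_mul, Real.cos_sub, Real.cos_add]
    ring
  simp only [h1]
  rw [intervalIntegral.integral_const_mul, intervalIntegral.integral_sub
    (Continuous.intervalIntegrable (by fun_prop) _ _)
    (Continuous.intervalIntegrable (by fun_prop) _ _), integral_cos_int_mul_two_pi,
    integral_cos_int_mul_two_pi]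
  have h2 : (m + j : ℤ) ≠ 0 := by omega
  have h3 : (m - j : ℤ) = 0 ↔ j = m := by omega
  simp only [h2, h3, if_false]
  split_ifs <;> ring

theorem integral_cos_mul_cos_two_pi (hm : 1 ≤ m) :
    ∫ θ in (0 : ℝ)..2 * Real.pi, Real.cos (m * θ) * Real.cos (j * θ) =
      if j = m then Real.pi else 0 := by
  have h1 : ∀ θ : ℝ, Real.cos (m * θ) * Real.cos (j * θ) =
      (1 / 2) * (Real.cos (((m - j : ℤ) : ℝ) * θ) + Real.cos (((m + j : ℤ) : ℝ) * θ)) := by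
    intro θ
    push_cast
    rw [sub_mul, add_mul, Real.cos_sub, Real.cos_add]
    ring
  simp only [h1]
  rw [intervalIntegral.integral_const_mul, intervalIntegral.integral_add
    (Continuous.intervalIntegrable (by fun_prop) _ _)
    (Continuous.intervalIntegrable (by fun_prop) _ _), integral_cos_int_mul_two_pi,
    integral_cos_int_mul_two_pi]
  have h2 : (m + j : ℤ) ≠ 0 := by omega
  have h3 : (m - j : ℤ) = 0 ↔ j = m := by omega
  simp only [h2, h3, if_false]
  split_ifs <;> ring

theorem integral_sin_mul_cos_two_pi (m j : ℕ) :
    ∫ θ in (0 : ℝ)..2 * Real.pi, Real.sin (m * θ) * Real.cos (j * θ) = 0 := by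
  have h1 : ∀ θ : ℝ, Real.sin (m * θ) * Real.cos (j * θ) =
      (1 / 2) * (Real.sin (((m - j : ℤ) : ℝ) * θ) + Real.sin (((m + j : ℤ) : ℝ) * θ)) := by
    intro θ
    push_cast
    rw [sub_mul, add_mul, Real.sin_sub, Real.sin_add]
    ring
  simp only [h1]
  rw [intervalIntegral.integral_const_mul, intervalIntegral.integral_add
    (Continuous.intervalIntegrable (by fun_prop) _ _)
    (Continuous.intervalIntegrable (by fun_prop) _ _), integral_sin_int_mul_two_pi,
    integral_sin_int_mul_two_pi]
  simp

end Orthogonality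

/-- A trigonometric polynomial of degree `N` vanishing at the multiples of `2π`. -/
def trigPoly (N : ℕ) (a c : ℕ → ℝ) (σ : ℝ) : ℝ :=
  ∑ j ∈ Finset.Icc 1 N, (a j * Real.sin (j * σ) + c j * (Real.cos (j * σ) - 1))

section TrigPoly

variable (N : ℕ) (a c : ℕ → ℝ)

theorem continuous_trigPoly : Continuous (trigPoly N a c) := by
  unfold trigPoly
  fun_prop

/-- This makes `trigControl` continuous where it is switched on. The subtracted constants cost
nothing, being orthogonal to all modes `m ≥ 1`. -/
theorem trigPoly_two_pi : trigPoly N a c (2 * Real.pi) = 0 := by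
  refine Finset.sum_eq_zero fun j _ => ?_
  have h2 : Real.sin (j * (2 * Real.pi)) = 0 := by
    have := Real.sin_nat_mul_pi (j * 2)
    rwa [Nat.cast_mul, Nat.cast_ofNat, mul_assoc] at this
  simp [h2, Real.cos_nat_mul_two_pi]

theorem integral_mul_trigPoly {f : ℝ → ℝ} (hf : Continuous f) :
    ∫ σ in (0 : ℝ)..2 * Real.pi, f σ * trigPoly N a c σ =
      ∑ j ∈ Finset.Icc 1 N, (a j * (∫ σ in (0 : ℝ)..2 * Real.pi, f σ * Real.sin (j * σ)) +
        c j * ((∫ σ in (0 : ℝ)..2 * Real.pi, f σ * Real.cos (j * σ)) -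
          ∫ σ in (0 : ℝ)..2 * Real.pi, f σ)) := by
  simp only [trigPoly, Finset.mul_sum]
  rw [intervalIntegral.integral_finsetSum
    fun j _ => Continuous.intervalIntegrable (by fun_prop) _ _]
  refine Finset.sum_congr rfl fun j _ => ?_
  rw [← intervalIntegral.integral_sub (Continuous.intervalIntegrable (by fun_prop) _ _)
    (Continuous.intervalIntegrable (by fun_prop) _ _), ← intervalIntegral.integral_const_mul,
    ← intervalIntegral.integral_const_mul,
    ← intervalIntegral.integral_add (Continuous.intervalIntegrable (by fun_prop) _ _)
    (Continuous.intervalIntegrable (by fun_prop) _ _)]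
  refine intervalIntegral.integral_congr fun σ _ => ?_
  ring

theorem integral_sin_mul_trigPoly {m : ℕ} (hm : 1 ≤ m) :
    ∫ σ in (0 : ℝ)..2 * Real.pi, Real.sin (m * σ) * trigPoly N a c σ =
      if m ≤ N then Real.pi * a m else 0 := by
  have h1 := integral_sin_int_mul_two_pi m
  rw [Int.cast_natCast] at h1
  rw [integral_mul_trigPoly N a c (by fun_prop)]
  simp only [integral_sin_mul_sin_two_pi hm, integral_sin_mul_cos_two_pi, h1, sub_self, mul_zero,
    add_zero, mul_ite, Finset.sum_ite_eq', Finset.mem_Icc, hm, true_and, mul_comm (a m)]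

theorem integral_cos_mul_trigPoly {m : ℕ} (hm : 1 ≤ m) :
    ∫ σ in (0 : ℝ)..2 * Real.pi, Real.cos (m * σ) * trigPoly N a c σ =
      if m ≤ N then Real.pi * c m else 0 := by
  have h1 := integral_cos_int_mul_two_pi m
  have h2 : (m : ℤ) ≠ 0 := by omega
  rw [Int.cast_natCast, if_neg h2] at h1
  have h3 : ∀ j : ℕ, ∫ σ in (0 : ℝ)..2 * Real.pi, Real.cos (m * σ) * Real.sin (j * σ) = 0 :=
    fun j => by simpa only [mul_comm] using integral_sin_mul_cos_two_pi j m
  rw [integral_mul_trigPoly N a c (by fun_prop)]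
  simp only [integral_cos_mul_cos_two_pi hm, h3, h1, sub_zero, mul_zero,
    zero_add, mul_ite, Finset.sum_ite_eq', Finset.mem_Icc, hm, true_and, mul_comm (c m)]

/-- The control equal to a trigonometric polynomial on the last `2π` of `[0, b]`,
and to zero before. -/
def trigControl (b : ℝ) (τ : ℝ) : ℝ :=
  if τ ≤ b - 2 * Real.pi then 0 else trigPoly N a c (b - τ)

theorem continuous_trigControl (b : ℝ) : Continuous (trigControl N a c b) := by
  refine Continuous.if_le continuous_const
    ((continuous_trigPoly N a c).comp (continuous_const.sub continuous_id)) continuous_id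
    continuous_const fun τ hτ => ?_
  rw [hτ, sub_sub_cancel, trigPoly_two_pi]

/-- Reversed time `σ = b - τ` turns the Duhamel kernels `sin(m(b-τ))`, `cos(m(b-τ))` into `sin(mσ)`,
`cos(mσ)` on a full period. -/
theorem integral_mul_trigControl {b : ℝ} (hb : 2 * Real.pi ≤ b) {f : ℝ → ℝ} (hf : Continuous f) :
    ∫ τ in (0 : ℝ)..b, f τ * trigControl N a c b τ =
      ∫ σ in (0 : ℝ)..2 * Real.pi, f (b - σ) * trigPoly N a c σ := by
  have hu := continuous_trigControl N a c b
  have hpi := Real.pi_pos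
  rw [← intervalIntegral.integral_add_adjacent_intervals (b := b - 2 * Real.pi)
    (Continuous.intervalIntegrable (by fun_prop) _ _)
    (Continuous.intervalIntegrable (by fun_prop) _ _)]
  have h1 : ∫ τ in (0 : ℝ)..b - 2 * Real.pi, f τ * trigControl N a c b τ = 0 := by
    rw [intervalIntegral.integral_congr (g := fun _ => 0), intervalIntegral.integral_zero]
    intro τ hτ
    rw [uIcc_of_le (by linarith)] at hτ
    simp [trigControl, hτ.2]
  have h2 : ∫ τ in b - 2 * Real.pi..b, f τ * trigControl N a c b τ =
      ∫ τ in b - 2 * Real.pi..b, f (b - (b - τ)) * trigPoly N a c (b - τ) := by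
    refine intervalIntegral.integral_congr fun τ hτ => ?_
    rw [uIcc_of_le (by linarith)] at hτ
    simp only [trigControl, sub_sub_cancel]
    split_ifs with h
    · have : τ = b - 2 * Real.pi := le_antisymm h hτ.1
      rw [this, sub_sub_cancel, trigPoly_two_pi]
    · rfl
  rw [h1, h2, intervalIntegral.integral_comp_sub_left
    (fun σ => f (b - σ) * trigPoly N a c σ) b, sub_self, sub_sub_cancel, zero_add]

theorem modal_sin_integral_trigControl {b : ℝ} (hb : 2 * Real.pi ≤ b) {m : ℕ} (hm : 1 ≤ m) :
    Real.sin (m * b) * (∫ τ in (0 : ℝ)..b, Real.cos (m * τ) * trigControl N a c b τ) -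
      Real.cos (m * b) * (∫ τ in (0 : ℝ)..b, Real.sin (m * τ) * trigControl N a c b τ) =
      if m ≤ N then Real.pi * a m else 0 := by
  have hu := continuous_trigControl N a c b
  rw [← integral_sin_mul_trigPoly N a c hm, ← intervalIntegral.integral_const_mul,
    ← intervalIntegral.integral_const_mul, ← intervalIntegral.integral_sub
    (Continuous.intervalIntegrable (by fun_prop) _ _)
    (Continuous.intervalIntegrable (by fun_prop) _ _)]
  have h1 := integral_mul_trigControl N a c hb
    (f := fun τ => Real.sin (m * (b - τ))) (by fun_prop)
  simp only [sub_sub_cancel] at h1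
  rw [← h1]
  refine intervalIntegral.integral_congr fun τ _ => ?_
  simp only [mul_sub, Real.sin_sub]
  ring

theorem modal_cos_integral_trigControl {b : ℝ} (hb : 2 * Real.pi ≤ b) {m : ℕ} (hm : 1 ≤ m) :
    Real.cos (m * b) * (∫ τ in (0 : ℝ)..b, Real.cos (m * τ) * trigControl N a c b τ) +
      Real.sin (m * b) * (∫ τ in (0 : ℝ)..b, Real.sin (m * τ) * trigControl N a c b τ) =
      if m ≤ N then Real.pi * c m else 0 := by
  have hu := continuous_trigControl N a c b
  rw [← integral_cos_mul_trigPoly N a c hm, ← intervalIntegral.integral_const_mul,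
    ← intervalIntegral.integral_const_mul, ← intervalIntegral.integral_add
    (Continuous.intervalIntegrable (by fun_prop) _ _)
    (Continuous.intervalIntegrable (by fun_prop) _ _)]
  have h1 := integral_mul_trigControl N a c hb
    (f := fun τ => Real.cos (m * (b - τ))) (by fun_prop)
  simp only [sub_sub_cancel] at h1
  rw [← h1]
  refine intervalIntegral.integral_congr fun τ _ => ?_
  simp only [mul_sub, Real.cos_sub]
  ring

end TrigPoly

/-! ### Approximate controllability -/

/-- Compared with the uncontrolled trajectory `w₀`, a suitable control changes the state at time
`b` so that the first `N` modes of a given state `y` are cancelled and the others are unchanged. -/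
theorem exists_control_cancelling_modes {b : ℝ} (hb : 2 * Real.pi ≤ b) {h : L2}
    (hγ : ∀ m : ℕ, 1 ≤ m → sineCoeff h m ≠ 0) {z₀ : State} (hz₀ : z₀ ∈ stateSpace)
    {w₀ : ℝ → State}
    (hw₀ : ∀ m : ℕ, m * sineCoeff (w₀ b).1 m =
        modalDisp (fun _ => 0) 0 (sineCoeff z₀.1 m) (sineCoeff z₀.2 m) (sineCoeff h m) m b ∧
      sineCoeff (w₀ b).2 m =
        modalVel (fun _ => 0) 0 (sineCoeff z₀.1 m) (sineCoeff z₀.2 m) (sineCoeff h m) m b)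
    (y : State) (N : ℕ) :
    ∃ u w, Continuous u ∧ IsTrajectory h u w ∧ w 0 = z₀ ∧ ∀ m,
      energyTerm (w b - w₀ b + y) m = if m ≤ N then 0 else energyTerm y m := by
  -- These solve `γ_m π a_m = -m α_m(y)` and `γ_m π c_m = -β_m(y)`; here `γ_m ≠ 0` is essential.
  set a : ℕ → ℝ := fun m => -(m * sineCoeff y.1 m) / (sineCoeff h m * Real.pi) with ha
  set c : ℕ → ℝ := fun m => -sineCoeff y.2 m / (sineCoeff h m * Real.pi) with hc
  have hu := continuous_trigControl N a c b
  obtain ⟨w, hw, hw0, hwm⟩ := exists_trajectory h hu 0 hz₀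
  refine ⟨_, w, hu, hw, hw0, fun m => ?_⟩
  rcases Nat.eq_zero_or_pos m with rfl | hm
  · simp [energyTerm]
  have hγm := hγ m hm
  have hpi := Real.pi_ne_zero
  have e1 : m * (sineCoeff (w b).1 m - sineCoeff (w₀ b).1 m) =
      sineCoeff h m * if m ≤ N then Real.pi * a m else 0 := by
    rw [mul_sub, (hwm b m).1, (hw₀ m).1, ← modal_sin_integral_trigControl N a c hb hm]
    simp only [modalDisp, mul_zero, intervalIntegral.integral_zero, sub_zero]
    ring
  have e2 : sineCoeff (w b).2 m - sineCoeff (w₀ b).2 m =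
      sineCoeff h m * if m ≤ N then Real.pi * c m else 0 := by
    rw [(hwm b m).2, (hw₀ m).2, ← modal_cos_integral_trigControl N a c hb hm]
    simp only [modalVel, mul_zero, intervalIntegral.integral_zero, add_zero]
    ring
  simp only [energyTerm, Prod.fst_add, Prod.snd_add, Prod.fst_sub, Prod.snd_sub, sineCoeff_add,
    sineCoeff_sub, ← mul_pow, mul_add, e1, e2]
  split_ifs with hmN
  · simp only [ha, hc]
    field_simp
    ring
  · simp

theorem exists_energyNorm_lt {y : State} (hy : y ∈ stateSpace) {ε : ℝ} (hε : 0 < ε) :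
    ∃ N : ℕ, ∀ v : State, (∀ m, energyTerm v m = if m ≤ N then 0 else energyTerm y m) →
      energyNorm v < ε := by
  have h1 := tendsto_sum_nat_add (energyTerm y)
  obtain ⟨N, hN⟩ := (((tendsto_order.1 h1).2 (ε ^ 2) (by positivity)).and
    (eventually_ge_atTop 1)).exists
  -- The small tail starts at `N + 1` for the new `N`, matching the cut-off `m ≤ N`.
  obtain ⟨N, rfl⟩ := Nat.exists_eq_add_of_le' hN.2
  refine ⟨N, fun v hv => ?_⟩
  have hvs : Summable (energyTerm v) := by
    refine Summable.of_nonneg_of_le (energyTerm_nonneg v) (fun m => ?_) hy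
    rw [hv]
    split_ifs
    · exact energyTerm_nonneg y m
    · rfl
  have h2 : ∑' m, energyTerm v m = ∑' m, energyTerm y (m + (N + 1)) := by
    rw [← hvs.sum_add_tsum_nat_add (N + 1), Finset.sum_eq_zero, zero_add]
    · refine tsum_congr fun m => ?_
      rw [hv, if_neg (by omega)]
    · intro m hm
      rw [hv, if_pos (by have := Finset.mem_range.1 hm; omega)]
  refine lt_of_pow_lt_pow_left₀ 2 hε.le ?_
  rw [energyNorm_sq, h2]
  exact hN.1

theorem approximatelyControllable_of_sineCoeff_ne_zero {p : ℕ} {t : Fin (p + 2) → ℝ}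
    (ht : StrictMono t) (ht0 : t 0 = 0) (hb : 2 * Real.pi ≤ t (Fin.last (p + 1))) {h : L2}
    (hγ : ∀ m : ℕ, 1 ≤ m → sineCoeff h m ≠ 0) {J : Fin p → State}
    (hJ : ∀ i, J i ∈ stateSpace) : ApproximatelyControllable t h J := by
  intro z₀ hz₀ z₁ hz₁ ε hε
  set b := t (Fin.last (p + 1)) with hbdef
  choose W hW hWJ _ using fun i =>
    exists_trajectory h (continuous_const (y := (0 : ℝ))) (t (Fin.succ (Fin.castSucc i))) (hJ i)
  obtain ⟨w₀, hw₀, -, hw₀m⟩ := exists_trajectory h (continuous_const (y := (0 : ℝ))) 0 hz₀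
  -- The contribution of the impulses at time `b`, the same for every control.
  set K : State := ∑ i with t (Fin.succ (Fin.castSucc i)) < b, W i b with hK
  have hy : w₀ b + K - z₁ ∈ stateSpace :=
    sub_mem_stateSpace (add_mem_stateSpace (hw₀.mem b)
      (sum_mem_stateSpace _ fun i _ => (hW i).mem b)) hz₁
  obtain ⟨N, hN⟩ := exists_energyNorm_lt hy hε
  obtain ⟨u, w, hu, hw, hw0, hwm⟩ := exists_control_cancelling_modes hb hγ hz₀
    (hw₀m b) (w₀ b + K - z₁) N
  have hsol : IsSolution t h J z₀ u (superpose (fun i => t i.castSucc.succ) w W) :=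
    isSolution_superpose ht hu hw (by rw [ht0, hw0]) hW hWJ
  refine ⟨u, ?_, ⟨_, hsol⟩, fun x hx => ?_⟩
  · obtain ⟨C, hC⟩ := (isCompact_Icc (a := t 0) (b := b)).exists_bound_of_continuousOn
      hu.continuousOn
    exact MemLp.of_bound hu.aestronglyMeasurable C
      ((ae_restrict_iff' measurableSet_Icc).2 (Eventually.of_forall hC))
  · rw [hx.last_unique hsol hu hJ (ht.monotone (Fin.zero_le _))]
    refine hN _ fun m => ?_
    rw [← hwm m]
    congr 1
    simp only [superpose, ← hbdef, ← hK]
    abel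

end ImpulsiveWave

end

/-- Let `0 = t₀ < t₁ < … < t_p < t_{p+1} = b` with `b - t_p ≥ 2π`, let `h ∈ L²(0, π)` have
nonzero sine coefficients `γ_m`, `m ≥ 1`, and let the jumps `(aᵢ, bᵢ)` be any elements of `H`.
Then the impulsive wave equation is approximately controllable on `[0, b]`. -/
theorem theorem2 (p : ℕ) (b : ℝ) (t : Fin (p + 2) → ℝ) (ht : StrictMono t)
    (ht_zero : t 0 = 0) (ht_last : t (Fin.last (p + 1)) = b)
    (hb : b - t (Fin.last p).castSucc ≥ 2 * Real.pi)
    (h : ImpulsiveWave.L2) (hγ : ∀ m : ℕ, 1 ≤ m → ImpulsiveWave.sineCoeff h m ≠ 0)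
    (J : Fin p → ImpulsiveWave.State) (hJ : ∀ i, J i ∈ ImpulsiveWave.stateSpace) :
    ImpulsiveWave.ApproximatelyControllable t h J := by
  -- Since `t_p ≥ 0`, the gap condition gives `b ≥ 2π`.
  have h1 := ht.monotone (Fin.zero_le (Fin.last p).castSucc)
  exact ImpulsiveWave.approximatelyControllable_of_sineCoeff_ne_zero ht ht_zero (by linarith) hγ hJ
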